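/- **Setting.** Manifolds are finite-dimensional, Hausdorff, second countable and smooth. Let $Q$ be a manifold, and let $G$ be a Lie group acting smoothly on the left on $Q$ such that the quotient map $\pi: Q\to Q/G$ is a principal $G$-bundle. A *forced discrete mechanical system* $(Q,L_d,f_d)$ consists of a smooth function $L_d:Q\times Q\to\mathbb R$ and a smooth $1$-form $f_d$ on $Q\times Q$. A discrete curve $q_0,\dots,q_N$ in $Q$ is a *trajectory* if $$\delta\Big(\sum_{k=0}^{N-1}L_d(q_k,q_{k+1})\Big)+\sum_{k=0}^{N-1}f_d(q_k,q_{k+1})(\delta q_k,\delta q_{k+1})=0$$ for all variations $\delta q_k\in T_{q_k}Q$ with $\delta q_0=0$, $\delta q_N=0$. A map $\mathbf F:Q\times Q\to Q\times Q$ is the *flow* of the system if $\mathbf F(q_0,q_1)=(q_1,q_2)$, where $q_2$ is the unique point such that $(q_0,q_1,q_2)$ is a trajectory. $G$ is a *symmetry group* of the system if $L_d$ and $f_d$ are invariant under the diagonal action of $G$ on $Q\times Q$. Let $\mathfrak A:TQ\to\mathfrak g$ be a principal connection on $\pi$, with horizontal lift $h$, and let $\mathcal A_d:Q\times Q\to G$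 be an affine discrete connection, i.e. a smooth map with $\mathcal A_d(g_0q_0,g_1q_1)=g_1\mathcal A_d(q_0,q_1)g_0^{-1}$ and $\mathcal A_d(q,\gamma(q)q)=e$ for some smooth $\gamma:Q\to G$ with $\gamma(gq)=g\gamma(q)g^{-1}$. Let $\tilde G:=(Q\times G)/G$ be the conjugate bundle, where $g\cdot(q,w)=(gq,gwg^{-1})$, let $\rho:Q\times G\to\tilde G$ be the quotient map, and let $$\Upsilon:Q\times Q\to\tilde G\times Q/G,\qquad \Upsilon(q_0,q_1)=(\rho(q_0,\mathcal A_d(q_0,q_1)),\pi(q_1)).$$ If $G$ is a symmetry group, the reduced Lagrangian $\hat L_d$ on $\tilde G\times Q/G$ is determined by $\hat L_d\circ\Upsilon=L_d$, and the reduced force $\hat f_d$ by $$\hat f_d(\Upsilon(x))\big(T\Upsilon(v)\oplus[x,\tfrac12(\mathfrak A(v_0)+\mathfrak A(v_1))]\big)=f_d(x)(v)\qquad\text{for } x\in Q\times Q,\ v=(v_0,v_1)\in T_x(Q\times Q),$$ where $[x,\xi]$ denotes the class of $(x,\xi)$ in $((Q\times Q)\times\mathfrak g)/G$ ($G$ acting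 diagonally on $Q \times Q$ and by $\mathrm{Ad}$ on $\mathfrak g$). A discrete curve $(v_0,\tau_1),\dots,(v_{N-1},\tau_N)$ in $\tilde G\times Q/G$ is a *trajectory of the reduced system* if $(v_k,\tau_{k+1})=\Upsilon(q_k,q_{k+1})$ for some discrete curve $q_0,\dots,q_N$ in $Q$ and $$\delta\Big(\sum_{k=0}^{N-1}\hat L_d(v_k,\tau_{k+1})\Big)+\sum_{k=0}^{N-1}\hat f_d(v_k,\tau_{k+1})\big((\delta v_k,\delta\tau_{k+1})\oplus[(q_k,q_{k+1}),\tfrac12(\xi_k+\xi_{k+1})]\big)=0$$ for all $\delta\tau_k\in T_{\pi(q_k)}(Q/G)$ and $\xi_k\in\mathfrak g$ ($0\le k\le N$) with $\delta\tau_0=0$, $\delta\tau_N=0$, $\xi_0=\xi_N=0$, where, with $w_k=\mathcal A_d(q_k,q_{k+1})$, $$\delta v_k=T_{(q_k,w_k)}\rho\big(h^{q_k}(\delta\tau_k),T\mathcal A_d(h^{q_k}(\delta\tau_k),h^{q_{k+1}}(\delta\tau_{k+1}))\big)+T_{(q_k,w_k)}\rho\big((\xi_k)_Q(q_k),T\mathcal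 A_d((\xi_k)_Q(q_k),(\xi_{k+1})_Q(q_{k+1}))\big).$$ A map $\hat{\mathbf F}$ of $\tilde G\times Q/G$ into itself is the *flow of the reduced system* if $\hat{\mathbf F}(v_0,\tau_1)$ is the unique $(v_1,\tau_2)$ such that $(v_0,\tau_1),(v_1,\tau_2)$ is a trajectory of the reduced system. A *Poisson map* is a smooth map $F$ between Poisson manifolds with $F^*\{g,h\}_2=\{F^*g,F^*h\}_1$ for all smooth $g,h$; a map of a Poisson manifold into itself *preserves* the Poisson structure if it is a Poisson map. **Proposition.** Let $(Q,L_d,f_d)$ be a forced discrete mechanical system with symmetry group $G$ and flow $\mathbf F:Q\times Q\to Q\times Q$, and let $\{\cdot,\cdot\}$ be a Poisson structure on $Q\times Q$ that is preserved by $\mathbf F$ and for which $G$ acts (diagonally) on $Q\times Q$ by Poisson maps. Then there is a Poisson structure $\{\cdot,\cdot\}_r$ on $\tilde G\times Q/G$ such that $\Upsilon$ is a Poisson map, and the reduced system has a flow $\hat{\mathbf F}$, which preserves $\{\cdot,\cdot\}_r$. -/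

import Mathlib

open scoped Manifold ContDiff
noncomputable section

open Set

set_option linter.unusedSectionVars false

namespace DiscreteReduction

variable {EQ EG EB : Type*}
  [NormedAddCommGroup EQ] [NormedSpace ℝ EQ]
  [NormedAddCommGroup EG] [NormedSpace ℝ EG]
  [NormedAddCommGroup EB] [NormedSpace ℝ EB]
  {G Q : Type*} [TopologicalSpace G] [ChartedSpace EG G] [Group G]
  [TopologicalSpace Q] [ChartedSpace EQ Q] [MulAction G Q]

section PrincipalBundles

variable (G Q) in
/-- The orbit space `Q/G`, with the quotient topology. -/
abbrev OrbitSpace : Type _ := MulAction.orbitRel.Quotient G Q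

variable (G) in
/-- The quotient map `π : Q → Q/G`. -/
def orbitProj (q : Q) : OrbitSpace G Q := Quotient.mk _ q

lemma orbitProj_smul (g : G) (q : Q) : orbitProj G (g • q) = orbitProj G q :=
  Quotient.sound ⟨g, rfl⟩

lemma continuous_orbitProj : Continuous (orbitProj G : Q → OrbitSpace G Q) :=
  continuous_quotient_mk'

variable [ChartedSpace EB (OrbitSpace G Q)]

variable (EQ EG EB G Q) in
/-- A smooth equivariant local trivialization `π⁻¹(U) ≅ U × G`, `q ↦ (π(q), φ(q))` with
`φ(g q) = g φ(q)`, of the quotient map `π : Q → Q/G`, where `U = baseSet`. -/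
structure EquivariantTrivialization extends OpenPartialHomeomorph Q (OrbitSpace G Q × G) where
  baseSet : Set (OrbitSpace G Q)
  open_baseSet : IsOpen baseSet
  source_eq : source = orbitProj G ⁻¹' baseSet
  target_eq : target = baseSet ×ˢ univ
  coe_fst : ∀ q ∈ source, (toOpenPartialHomeomorph q).1 = orbitProj G q
  coe_smul_snd : ∀ (g : G), ∀ q ∈ source, (toOpenPartialHomeomorph (g • q)).2 = g * (toOpenPartialHomeomorph q).2
  contMDiffOn_coe : ContMDiffOn 𝓘(ℝ, EQ) (𝓘(ℝ, EB).prod 𝓘(ℝ, EG)) ∞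
    toOpenPartialHomeomorph source
  contMDiffOn_symm : ContMDiffOn (𝓘(ℝ, EB).prod 𝓘(ℝ, EG)) 𝓘(ℝ, EQ) ∞
    toOpenPartialHomeomorph.symm target

namespace EquivariantTrivialization

variable (e : EquivariantTrivialization EQ EG EB G Q)

lemma orbitProj_symm {b : OrbitSpace G Q} (hb : b ∈ e.baseSet) (w : G) :
    orbitProj G (e.toOpenPartialHomeomorph.symm (b, w)) = b := by
  have h : (b, w) ∈ e.target := by rw [e.target_eq]; exact ⟨hb, mem_univ _⟩
  rw [← e.coe_fst _ (e.toOpenPartialHomeomorph.map_target h),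
    e.toOpenPartialHomeomorph.right_inv h]

lemma symm_one {q : Q} (hq : orbitProj G q ∈ e.baseSet) :
    e.toOpenPartialHomeomorph.symm (orbitProj G q, 1) =
      (e.toOpenPartialHomeomorph q).2⁻¹ • q := by
  have h : q ∈ e.source := by rw [e.source_eq]; exact hq
  have h' : (e.toOpenPartialHomeomorph q).2⁻¹ • q ∈ e.source := by
    rw [e.source_eq, mem_preimage, orbitProj_smul]; exact hq
  rw [← e.toOpenPartialHomeomorph.left_inv h']
  congr 1
  refine Prod.ext ?_ ?_
  · rw [e.coe_fst _ h', orbitProj_smul]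
  · rw [e.coe_smul_snd _ _ h, inv_mul_cancel]

end EquivariantTrivialization

variable (EQ EG EB G Q) in
/-- With the given smooth structure on `Q/G`, the quotient map `π : Q → Q/G` is a (left) principal
`G`-bundle: it is smoothly and equivariantly trivial over a neighbourhood of each point. -/
structure IsPrincipalBundle : Prop where
  exists_trivialization : ∀ b : OrbitSpace G Q,
    ∃ e : EquivariantTrivialization EQ EG EB G Q, b ∈ e.baseSet

variable (G Q) in
/-- Two points of `Q × G` are related if they lie in the same orbit of the action
`g · (q, w) = (g q, g w g⁻¹)`. -/
def conjugateSetoid : Setoid (Q × G) where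
  r p p' := ∃ g : G, (g • p.1, g * p.2 * g⁻¹) = p'
  iseqv :=
    { refl := fun p => ⟨1, by simp⟩
      symm := by
        rintro p _ ⟨g, rfl⟩
        exact ⟨g⁻¹, by simp [mul_assoc]⟩
      trans := by
        rintro p _ _ ⟨g, rfl⟩ ⟨h, rfl⟩
        exact ⟨h * g, by simp [mul_smul, mul_assoc]⟩ }

/-- The conjugate bundle `G̃ = (Q × G)/G` of a principal `G`-bundle `π : Q → Q/G`, where `G` acts on
`Q × G` by `g · (q, w) = (g q, g w g⁻¹)`. (The bundle `hπ` is only recorded as an index, so that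
the smooth structure of `G̃` can be found by instance search.) -/
@[nolint unusedArguments]
def ConjugateBundle (_hπ : IsPrincipalBundle EQ EG EB G Q) : Type _ :=
  Quotient (conjugateSetoid G Q)

namespace ConjugateBundle

variable (hπ : IsPrincipalBundle EQ EG EB G Q)

/-- The quotient map `ρ : Q × G → G̃`. -/
def mk (p : Q × G) : ConjugateBundle hπ := Quotient.mk _ p

instance : TopologicalSpace (ConjugateBundle hπ) :=
  inferInstanceAs (TopologicalSpace (Quotient (conjugateSetoid G Q)))

lemma continuous_mk : Continuous (mk hπ) := continuous_quotient_mk'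

lemma mk_surjective : Function.Surjective (mk hπ) := Quotient.mk_surjective

lemma mk_smul (g : G) (q : Q) (w : G) : mk hπ (g • q, g * w * g⁻¹) = mk hπ (q, w) :=
  (Quotient.sound ⟨g, rfl⟩ : mk hπ (q, w) = mk hπ (g • q, g * w * g⁻¹)).symm

lemma mk_eq_iff {p p' : Q × G} :
    mk hπ p = mk hπ p' ↔ ∃ g : G, (g • p.1, g * p.2 * g⁻¹) = p' :=
  Quotient.eq (r := conjugateSetoid G Q)

/-- The bundle projection `G̃ → Q/G`, `[q, w] ↦ π(q)`. -/
def proj : ConjugateBundle hπ → OrbitSpace G Q :=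
  Quotient.lift (fun p => orbitProj G p.1) (by
    rintro p _ ⟨g, rfl⟩
    exact (orbitProj_smul g p.1).symm)

@[simp] lemma proj_mk (p : Q × G) : proj hπ (mk hπ p) = orbitProj G p.1 := rfl

lemma continuous_proj : Continuous (proj hπ) :=
  (continuous_orbitProj.comp continuous_fst).quotient_lift _

open Classical in
/-- The fibre coordinate of `G̃` in an equivariant trivialization `q ↦ (π(q), φ(q))` of `Q`, namely
`[q, w] ↦ φ(q)⁻¹ w φ(q)` (and `1` outside of the domain). -/
def fibreCoord (e : EquivariantTrivialization EQ EG EB G Q) : ConjugateBundle hπ → G :=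
  Quotient.lift
    (fun p => if orbitProj G p.1 ∈ e.baseSet then (e.toOpenPartialHomeomorph p.1).2⁻¹ * p.2 * (e.toOpenPartialHomeomorph p.1).2 else 1)
    (by
      rintro ⟨q, w⟩ _ ⟨g, rfl⟩
      by_cases h : orbitProj G q ∈ e.baseSet
      · have hq : q ∈ e.source := by rw [e.source_eq]; exact h
        simp [orbitProj_smul, h, e.coe_smul_snd g q hq, mul_assoc]
      · simp [orbitProj_smul, h])

lemma fibreCoord_mk (e : EquivariantTrivialization EQ EG EB G Q) {q : Q}
    (hq : orbitProj G q ∈ e.baseSet) (w : G) :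
    fibreCoord hπ e (mk hπ (q, w)) = (e.toOpenPartialHomeomorph q).2⁻¹ * w * (e.toOpenPartialHomeomorph q).2 :=
  if_pos hq

variable [LieGroup 𝓘(ℝ, EG) ∞ G] [ContMDiffSMul 𝓘(ℝ, EG) 𝓘(ℝ, EQ) ∞ G Q]

lemma isOpenQuotientMap_mk : IsOpenQuotientMap (mk hπ) := by
  have : IsTopologicalGroup G := topologicalGroup_of_lieGroup 𝓘(ℝ, EG) ∞
  have : ContinuousSMul G Q :=
    ⟨(contMDiff_smul (I := 𝓘(ℝ, EG)) (I' := 𝓘(ℝ, EQ)) (n := ∞)).continuous⟩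
  refine ⟨mk_surjective hπ, continuous_mk hπ, fun U hU => ?_⟩
  have : mk hπ ⁻¹' (mk hπ '' U) =
      ⋃ g : G, (fun p : Q × G => (g • p.1, g * p.2 * g⁻¹)) ⁻¹' U := by
    ext p
    simp only [mem_preimage, mem_image, mem_iUnion]
    constructor
    · rintro ⟨p', hp', h⟩
      obtain ⟨g, hg⟩ := (mk_eq_iff hπ).1 h.symm
      exact ⟨g, by rw [hg]; exact hp'⟩
    · rintro ⟨g, hg⟩
      exact ⟨_, hg, mk_smul hπ g p.1 p.2⟩
  refine isOpen_coinduced.2 (?_ : IsOpen (mk hπ ⁻¹' (mk hπ '' U)))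
  rw [this]
  exact isOpen_iUnion fun g => hU.preimage (by fun_prop)

/-- The local trivialization `[q, w] ↦ (π(q), φ(q)⁻¹ w φ(q))` of `G̃` induced by an equivariant
trivialization `q ↦ (π(q), φ(q))` of `Q`. -/
def localTriv (e : EquivariantTrivialization EQ EG EB G Q) :
    OpenPartialHomeomorph (ConjugateBundle hπ) (OrbitSpace G Q × G) where
  toFun z := (proj hπ z, fibreCoord hπ e z)
  invFun y := mk hπ (e.toOpenPartialHomeomorph.symm (y.1, 1), y.2)
  source := proj hπ ⁻¹' e.baseSet
  target := e.baseSet ×ˢ univ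
  map_source' z hz := ⟨hz, mem_univ _⟩
  map_target' y hy := by
    change orbitProj G _ ∈ e.baseSet
    rw [e.orbitProj_symm hy.1]
    exact hy.1
  left_inv' z hz := by
    obtain ⟨⟨q, w⟩, rfl⟩ := mk_surjective hπ z
    have hq : orbitProj G q ∈ e.baseSet := hz
    rw [fibreCoord_mk hπ e hq, proj_mk, e.symm_one hq]
    convert mk_smul hπ (e.toOpenPartialHomeomorph q).2⁻¹ q w using 3
    simp
  right_inv' y hy := by
    have h := e.orbitProj_symm hy.1 (1 : G)
    rw [proj_mk, fibreCoord_mk hπ e (by rw [h]; exact hy.1)]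
    have h2 : e.toOpenPartialHomeomorph (e.toOpenPartialHomeomorph.symm (y.1, 1)) = (y.1, 1) :=
      e.toOpenPartialHomeomorph.right_inv (by rw [e.target_eq]; exact ⟨hy.1, mem_univ _⟩)
    simp [h, h2]
  continuousOn_toFun := by
    have : IsTopologicalGroup G := topologicalGroup_of_lieGroup 𝓘(ℝ, EG) ∞
    intro z hz
    refine ContinuousAt.continuousWithinAt ?_
    obtain ⟨⟨q, w⟩, rfl⟩ := mk_surjective hπ z
    refine (continuous_proj hπ).continuousAt.prodMk ?_
    rw [← (isOpenQuotientMap_mk hπ).continuousAt_comp_iff]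
    have hq : q ∈ e.source := by rw [e.source_eq]; exact hz
    have he : ContinuousAt (fun p : Q × G => (e.toOpenPartialHomeomorph p.1).2) (q, w) :=
      continuousAt_snd.comp
        ((e.toOpenPartialHomeomorph.continuousAt hq).comp (x := (q, w)) continuousAt_fst)
    refine ((he.inv.mul continuousAt_snd).mul he).congr ?_
    have : ∀ᶠ p : Q × G in nhds (q, w), p.1 ∈ e.source :=
      continuousAt_fst.eventually (e.open_source.mem_nhds hq)
    filter_upwards [this] with p hp
    rw [e.source_eq] at hp
    exact (fibreCoord_mk hπ e hp p.2).symm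
  continuousOn_invFun := by
    refine (continuous_mk hπ).comp_continuousOn (ContinuousOn.prodMk ?_ continuousOn_snd)
    refine e.toOpenPartialHomeomorph.symm.continuousOn.comp
      (continuousOn_fst.prodMk continuousOn_const) fun y hy => ?_
    rw [OpenPartialHomeomorph.symm_source, e.target_eq]
    exact ⟨hy.1, mem_univ _⟩
  open_source := e.open_baseSet.preimage (continuous_proj hπ)
  open_target := e.open_baseSet.prod isOpen_univ

/-- The change of local trivializations of `G̃` is smooth. -/
lemma contMDiffOn_localTriv_symm_trans [IsManifold 𝓘(ℝ, EQ) ∞ Q]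
    [IsManifold 𝓘(ℝ, EB) ∞ (OrbitSpace G Q)] (e e' : EquivariantTrivialization EQ EG EB G Q) :
    ContMDiffOn (𝓘(ℝ, EB).prod 𝓘(ℝ, EG)) (𝓘(ℝ, EB).prod 𝓘(ℝ, EG)) ∞
      (localTriv hπ e' ∘ (localTriv hπ e).symm) ((e.baseSet ∩ e'.baseSet) ×ˢ univ) := by
  have h1 : ContMDiffOn (𝓘(ℝ, EB).prod 𝓘(ℝ, EG)) 𝓘(ℝ, EQ) ∞
      (fun y : OrbitSpace G Q × G => e.toOpenPartialHomeomorph.symm (y.1, 1))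
      ((e.baseSet ∩ e'.baseSet) ×ˢ univ) := by
    refine e.contMDiffOn_symm.comp (contMDiffOn_fst.prodMk contMDiffOn_const) fun y hy => ?_
    rw [e.target_eq]
    exact ⟨hy.1.1, mem_univ _⟩
  have h2 : ContMDiffOn (𝓘(ℝ, EB).prod 𝓘(ℝ, EG)) 𝓘(ℝ, EG) ∞
      (fun y : OrbitSpace G Q × G =>
        (e'.toOpenPartialHomeomorph (e.toOpenPartialHomeomorph.symm (y.1, 1))).2)
      ((e.baseSet ∩ e'.baseSet) ×ˢ univ) := by
    refine contMDiff_snd.comp_contMDiffOn (e'.contMDiffOn_coe.comp h1 fun y hy => ?_)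
    rw [e'.source_eq]
    change orbitProj G _ ∈ e'.baseSet
    rw [e.orbitProj_symm hy.1.1]
    exact hy.1.2
  refine (contMDiffOn_fst.prodMk ((h2.inv.mul contMDiffOn_snd).mul h2)).congr fun y hy => ?_
  have h := e.orbitProj_symm hy.1.1 (1 : G)
  change (proj hπ (mk hπ (e.toOpenPartialHomeomorph.symm (y.1, 1), y.2)),
    fibreCoord hπ e' (mk hπ (e.toOpenPartialHomeomorph.symm (y.1, 1), y.2))) = _
  rw [proj_mk, fibreCoord_mk hπ e' (by rw [h]; exact hy.1.2), h]
  rfl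

/-- The charts of `G̃` are the local trivializations `G̃ ⊇ (π⁻¹(U) × G)/G ≅ U × G` followed by
charts of `Q/G × G`. -/
instance : ChartedSpace (ModelProd EB EG) (ConjugateBundle hπ) :=
  letI : ChartedSpace (OrbitSpace G Q × G) (ConjugateBundle hπ) :=
    { atlas := range (localTriv hπ)
      chartAt := fun z => localTriv hπ (hπ.exists_trivialization (proj hπ z)).choose
      mem_chart_source := fun z => (hπ.exists_trivialization (proj hπ z)).choose_spec
      chart_mem_atlas := fun _ => mem_range_self _ }
  ChartedSpace.comp (ModelProd EB EG) (OrbitSpace G Q × G) (ConjugateBundle hπ)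

instance [IsManifold 𝓘(ℝ, EQ) ∞ Q] [IsManifold 𝓘(ℝ, EB) ∞ (OrbitSpace G Q)] :
    IsManifold (𝓘(ℝ, EB).prod 𝓘(ℝ, EG)) ∞ (ConjugateBundle hπ) := by
  have : IsManifold 𝓘(ℝ, EG) ∞ G := inferInstance
  refine isManifold_of_contDiffOn _ _ _ ?_
  rintro _ _ ⟨_, ⟨e, rfl⟩, c, hc, rfl⟩ ⟨_, ⟨e', rfl⟩, c', hc', rfl⟩
  set I := 𝓘(ℝ, EB).prod 𝓘(ℝ, EG)
  have hc1 : ContMDiffOn I I ∞ c.symm c.target :=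
    contMDiffOn_symm_of_mem_maximalAtlas (StructureGroupoid.subset_maximalAtlas _ hc)
  have hc2 : ContMDiffOn I I ∞ c' c'.source :=
    contMDiffOn_of_mem_maximalAtlas (StructureGroupoid.subset_maximalAtlas _ hc')
  have ht := contMDiffOn_localTriv_symm_trans hπ e e'
  rw [← contMDiffOn_iff_contDiffOn]
  refine I.contMDiff.comp_contMDiffOn ?_
  have key : ContMDiffOn I I ∞ (c' ∘ (localTriv hπ e' ∘ (localTriv hπ e).symm) ∘ c.symm)
      ((localTriv hπ e ≫ₕ c).symm ≫ₕ (localTriv hπ e' ≫ₕ c')).source := by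
    have hs : ∀ x ∈ ((localTriv hπ e ≫ₕ c).symm ≫ₕ (localTriv hπ e' ≫ₕ c')).source,
        x ∈ c.target ∧ c.symm x ∈ (e.baseSet ∩ e'.baseSet) ×ˢ (univ : Set G) ∧
          (localTriv hπ e') ((localTriv hπ e).symm (c.symm x)) ∈ c'.source := by
      intro x hx
      simp only [mfld_simps] at hx
      obtain ⟨⟨hx1, hx2⟩, hx3, hx4⟩ := hx
      refine ⟨hx1, ⟨⟨hx2.1, ?_⟩, mem_univ _⟩, hx4⟩
      have h := e.orbitProj_symm hx2.1 (1 : G)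
      have hx3' : orbitProj G _ ∈ e'.baseSet := hx3
      rwa [h] at hx3'
    refine hc2.comp (ht.comp (hc1.mono fun x hx => (hs x hx).1) fun x hx => (hs x hx).2.1)
      fun x hx => (hs x hx).2.2
  exact key.comp (I.contMDiffOn_symm.mono inter_subset_right) fun x hx => hx.1

end ConjugateBundle
end PrincipalBundles

section PoissonStructures

variable {E H E' H' : Type*}
  [NormedAddCommGroup E] [NormedSpace ℝ E] [TopologicalSpace H]
  [NormedAddCommGroup E'] [NormedSpace ℝ E'] [TopologicalSpace H']
  {I : ModelWithCorners ℝ E H} {I' : ModelWithCorners ℝ E' H'}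
  {M M' : Type*} [TopologicalSpace M] [ChartedSpace H M]
  [TopologicalSpace M'] [ChartedSpace H' M']

variable (I M) in
/-- A Poisson structure on a manifold `M`: a Lie bracket on the real vector space `C^∞(M)` that is
a derivation in each argument. -/
structure PoissonStructure where
  bracket : C^∞⟮I, M; ℝ⟯ →ₗ[ℝ] C^∞⟮I, M; ℝ⟯ →ₗ[ℝ] C^∞⟮I, M; ℝ⟯
  skew : ∀ f g, bracket f g = -bracket g f
  jacobi : ∀ f g h,
    bracket f (bracket g h) + bracket g (bracket h f) + bracket h (bracket f g) = 0
  leibniz : ∀ f g h, bracket (f * g) h = f * bracket g h + bracket f h * g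

/-- A Poisson map: a smooth map `F` with `F^*{g, h}₂ = {F^*g, F^*h}₁` for all smooth `g`, `h`. -/
def IsPoissonMap (P₁ : PoissonStructure I M) (P₂ : PoissonStructure I' M') (F : M → M') : Prop :=
  ∃ hF : ContMDiff I I' ∞ F, ∀ g h : C^∞⟮I', M'; ℝ⟯,
    (P₂.bracket g h).comp ⟨F, hF⟩ = P₁.bracket (g.comp ⟨F, hF⟩) (h.comp ⟨F, hF⟩)

end PoissonStructures

section ForcedSystems

variable [IsManifold 𝓘(ℝ, EQ) ∞ Q]

variable (EQ Q) in
/-- A forced discrete mechanical system `(Q, L_d, f_d)`: a smooth discrete Lagrangian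
`L_d : Q × Q → ℝ` and a smooth `1`-form `f_d` on `Q × Q`. -/
structure ForcedDiscreteSystem where
  lagrangian : Q × Q → ℝ
  contMDiff_lagrangian : ContMDiff (𝓘(ℝ, EQ).prod 𝓘(ℝ, EQ)) 𝓘(ℝ, ℝ) ∞ lagrangian
  force : ∀ x : Q × Q, TangentSpace (𝓘(ℝ, EQ).prod 𝓘(ℝ, EQ)) x →L[ℝ] ℝ
  contMDiff_force : ContMDiff (𝓘(ℝ, EQ).prod 𝓘(ℝ, EQ))
    ((𝓘(ℝ, EQ).prod 𝓘(ℝ, EQ)).prod 𝓘(ℝ, EQ × EQ →L[ℝ] ℝ)) ∞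
    (fun x => Bundle.TotalSpace.mk' (EQ × EQ →L[ℝ] ℝ)
      (E := fun x => TangentSpace (𝓘(ℝ, EQ).prod 𝓘(ℝ, EQ)) x →L[ℝ] ℝ) x (force x))

namespace ForcedDiscreteSystem

variable (S : ForcedDiscreteSystem EQ Q)

/-- A discrete curve `q_0, …, q_N` is a trajectory if
`δ(∑ L_d(q_k, q_{k+1})) + ∑ f_d(q_k, q_{k+1})(δq_k, δq_{k+1}) = 0` for all infinitesimal variations
`δq` with fixed endpoints, i.e. with `δq_0 = 0` and `δq_N = 0`; here the variation of the discrete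
action is `∑ dL_d(q_k, q_{k+1})(δq_k, δq_{k+1})`. -/
def IsTrajectory {N : ℕ} (q : Fin (N + 1) → Q) : Prop :=
  ∀ δq : ∀ k, TangentSpace 𝓘(ℝ, EQ) (q k), δq 0 = 0 → δq (Fin.last N) = 0 →
    ∑ k : Fin N, (mfderiv (𝓘(ℝ, EQ).prod 𝓘(ℝ, EQ)) 𝓘(ℝ, ℝ) S.lagrangian (q k.castSucc, q k.succ)
        (δq k.castSucc, δq k.succ) : ℝ) +
      ∑ k : Fin N, S.force (q k.castSucc, q k.succ) (δq k.castSucc, δq k.succ) = 0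

/-- `F : Q × Q → Q × Q` is the flow of the system: `F(q_0, q_1) = (q_1, q_2)`, where `q_2` is the
unique point of `Q` such that `(q_0, q_1, q_2)` is a trajectory. -/
def IsFlow (F : Q × Q → Q × Q) : Prop :=
  ∀ q₀ q₁ : Q, (F (q₀, q₁)).1 = q₁ ∧
    ∀ q₂ : Q, S.IsTrajectory ![q₀, q₁, q₂] ↔ (F (q₀, q₁)).2 = q₂

variable (G) in
/-- `G` is a symmetry group of the system: `L_d` and `f_d` are invariant under the diagonal
action of `G` on `Q × Q`. -/
structure IsSymmetryGroup : Prop where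
  lagrangian_smul : ∀ (g : G) (x : Q × Q), S.lagrangian (g • x) = S.lagrangian x
  force_smul : ∀ (g : G) (x : Q × Q) (v : TangentSpace (𝓘(ℝ, EQ).prod 𝓘(ℝ, EQ)) x),
    S.force (g • x) (mfderiv (𝓘(ℝ, EQ).prod 𝓘(ℝ, EQ)) (𝓘(ℝ, EQ).prod 𝓘(ℝ, EQ))
      (fun y : Q × Q => g • y) x v) = S.force x v

end ForcedDiscreteSystem

end ForcedSystems

section Connections

variable (EQ) in
/-- The value at `q` of the infinitesimal generator `ξ_Q` of the action, i.e. the derivative of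
`t ↦ exp(t ξ) • q` at `t = 0`, which is the image of `ξ` under the derivative at `1` of the orbit
map `g ↦ g • q`. -/
def infinitesimalGenerator (ξ : GroupLieAlgebra 𝓘(ℝ, EG) G) (q : Q) :
    TangentSpace 𝓘(ℝ, EQ) q :=
  mfderiv 𝓘(ℝ, EG) 𝓘(ℝ, EQ) (fun g : G => g • q) 1 ξ

/-- The adjoint action of `G` on its Lie algebra: `Ad_g` is the derivative at `1` of
`h ↦ g h g⁻¹`. -/
def adjointAction (g : G) (ξ : GroupLieAlgebra 𝓘(ℝ, EG) G) : GroupLieAlgebra 𝓘(ℝ, EG) G :=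
  mfderiv 𝓘(ℝ, EG) 𝓘(ℝ, EG) (fun h : G => g * h * g⁻¹) 1 ξ

lemma adjointAction_one (ξ : GroupLieAlgebra 𝓘(ℝ, EG) G) : adjointAction (1 : G) ξ = ξ := by
  have : (fun h : G => 1 * h * 1⁻¹) = id := by ext; simp
  rw [adjointAction, this, mfderiv_id]
  rfl

lemma adjointAction_mul [LieGroup 𝓘(ℝ, EG) ∞ G] (g h : G) (ξ : GroupLieAlgebra 𝓘(ℝ, EG) G) :
    adjointAction (g * h) ξ = adjointAction g (adjointAction h ξ) := by
  have hd : ∀ (a x : G), MDifferentiableAt 𝓘(ℝ, EG) 𝓘(ℝ, EG) (fun k : G => a * k * a⁻¹) x := by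
    intro a x
    have : ContMDiff 𝓘(ℝ, EG) 𝓘(ℝ, EG) ∞ (fun k : G => a * k * a⁻¹) :=
      (contMDiff_const.mul contMDiff_id).mul contMDiff_const
    exact this.mdifferentiable (by simp) x
  have hcomp : (fun k : G => g * h * k * (g * h)⁻¹) =
      (fun k : G => g * k * g⁻¹) ∘ (fun k : G => h * k * h⁻¹) := by
    ext k
    simp [mul_assoc]
  have h1 : h * 1 * h⁻¹ = 1 := by simp
  unfold adjointAction
  rw [hcomp, mfderiv_comp (I' := 𝓘(ℝ, EG)) (1 : G) (hd g _) (hd h 1)]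
  rw [h1]
  rfl

variable (EQ EG G Q) in
/-- A principal connection on `π : Q → Q/G`: a smooth `𝔤`-valued `1`-form on `Q` which reproduces
the generators of the action and is equivariant for the adjoint action. -/
structure PrincipalConnection [IsManifold 𝓘(ℝ, EQ) ∞ Q] where
  form : ∀ q : Q, TangentSpace 𝓘(ℝ, EQ) q →L[ℝ] GroupLieAlgebra 𝓘(ℝ, EG) G
  contMDiff_form : ContMDiff 𝓘(ℝ, EQ) (𝓘(ℝ, EQ).prod 𝓘(ℝ, EQ →L[ℝ] EG)) ∞
    (fun q => Bundle.TotalSpace.mk' (EQ →L[ℝ] EG)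
      (E := fun q => TangentSpace 𝓘(ℝ, EQ) q →L[ℝ] EG) q (form q))
  form_generator : ∀ (ξ : GroupLieAlgebra 𝓘(ℝ, EG) G) (q : Q),
    form q (infinitesimalGenerator EQ ξ q) = ξ
  form_smul : ∀ (g : G) (q : Q) (v : TangentSpace 𝓘(ℝ, EQ) q),
    form (g • q) (mfderiv 𝓘(ℝ, EQ) 𝓘(ℝ, EQ) (fun x : Q => g • x) q v) =
      adjointAction g (form q v)

variable (EQ EG G Q) in
/-- An affine discrete connection `𝒜_d : Q × Q → G` (with domain `Q × Q`) of level `γ`, where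
`γ : Q → G` is smooth and equivariant with respect to conjugation. -/
structure AffineDiscreteConnection where
  level : Q → G
  contMDiff_level : ContMDiff 𝓘(ℝ, EQ) 𝓘(ℝ, EG) ∞ level
  level_smul : ∀ (g : G) (q : Q), level (g • q) = g * level q * g⁻¹
  toFun : Q × Q → G
  contMDiff_toFun : ContMDiff (𝓘(ℝ, EQ).prod 𝓘(ℝ, EQ)) 𝓘(ℝ, EG) ∞ toFun
  toFun_smul : ∀ (q₀ q₁ : Q) (g₀ g₁ : G),
    toFun (g₀ • q₀, g₁ • q₁) = g₁ * toFun (q₀, q₁) * g₀⁻¹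
  toFun_level : ∀ q : Q, toFun (q, level q • q) = 1

end Connections

section Reduction

variable [ChartedSpace EB (OrbitSpace G Q)]
  [LieGroup 𝓘(ℝ, EG) ∞ G] [ContMDiffSMul 𝓘(ℝ, EG) 𝓘(ℝ, EQ) ∞ G Q] [IsManifold 𝓘(ℝ, EQ) ∞ Q]

variable (EG G Q) in
/-- Two elements of `(Q × Q) × 𝔤` are related if they lie in the same orbit of the action
`g · (x, ξ) = (g x, Ad_g ξ)`. -/
def adjointSetoid : Setoid ((Q × Q) × GroupLieAlgebra 𝓘(ℝ, EG) G) where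
  r p p' := ∃ g : G, (g • p.1, adjointAction g p.2) = p'
  iseqv :=
    { refl := fun p => ⟨1, by rw [one_smul, adjointAction_one]⟩
      symm := by
        rintro p _ ⟨g, rfl⟩
        exact ⟨g⁻¹, by simp only [← adjointAction_mul, inv_mul_cancel, adjointAction_one,
          inv_smul_smul]⟩
      trans := by
        rintro p _ _ ⟨g, rfl⟩ ⟨h, rfl⟩
        exact ⟨h * g, by simp only [mul_smul, adjointAction_mul]⟩ }

variable (EG G Q) in
/-- The adjoint bundle `((Q × Q) × 𝔤)/G` of `Q × Q → (Q × Q)/G`. -/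
def AdjointBundle : Type _ := Quotient (adjointSetoid EG G Q)

/-- The class `[x, ξ]` in the adjoint bundle. -/
def AdjointBundle.mk (x : Q × Q) (ξ : GroupLieAlgebra 𝓘(ℝ, EG) G) : AdjointBundle EG G Q :=
  Quotient.mk (adjointSetoid EG G Q) (x, ξ)

namespace PrincipalConnection

variable (𝔄 : PrincipalConnection EQ EG G Q)

/-- The principal connection `(pr₁^* 𝔄 + pr₂^* 𝔄) / 2` on `Q × Q → (Q × Q)/G`. -/
def prodForm (x : Q × Q) (v : TangentSpace (𝓘(ℝ, EQ).prod 𝓘(ℝ, EQ)) x) :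
    GroupLieAlgebra 𝓘(ℝ, EG) G :=
  (1 / 2 : ℝ) • (𝔄.form x.1 (v : EQ × EQ).1 + 𝔄.form x.2 (v : EQ × EQ).2)

/-- The horizontal lift to `T_q Q` of a vector `u` tangent to `Q/G` at `π(q)`: the vector `v` with
`Tπ(v) = u` and `𝔄(v) = 0`. -/
def horizontalLift (q : Q) (u : TangentSpace 𝓘(ℝ, EB) (orbitProj G q)) :
    TangentSpace 𝓘(ℝ, EQ) q :=
  Classical.epsilon fun v => mfderiv 𝓘(ℝ, EQ) 𝓘(ℝ, EB) (orbitProj G) q v = u ∧ 𝔄.form q v = 0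

end PrincipalConnection

variable (hπ : IsPrincipalBundle EQ EG EB G Q) (𝒜 : AffineDiscreteConnection EQ EG G Q)

/-- The map `Υ : Q × Q → G̃ × Q/G`, `(q_0, q_1) ↦ (ρ(q_0, 𝒜_d(q_0, q_1)), π(q_1))`. -/
def reductionMap (x : Q × Q) : ConjugateBundle hπ × OrbitSpace G Q :=
  (ConjugateBundle.mk hπ (x.1, 𝒜.toFun x), orbitProj G x.2)

variable (𝔄 : PrincipalConnection EQ EG G Q)

/-- The map `T(Q × Q) → T(G̃ × Q/G) ⊕ 𝔤̂`,
`v ∈ T_x(Q × Q) ↦ TΥ(v) ⊕ [x, ½(𝔄(v_0) + 𝔄(v_1))]`. -/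
def reductionTangentMap (v : TangentBundle (𝓘(ℝ, EQ).prod 𝓘(ℝ, EQ)) (Q × Q)) :
    TangentBundle ((𝓘(ℝ, EB).prod 𝓘(ℝ, EG)).prod 𝓘(ℝ, EB))
      (ConjugateBundle hπ × OrbitSpace G Q) × AdjointBundle EG G Q :=
  (⟨reductionMap hπ 𝒜 v.1, mfderiv (𝓘(ℝ, EQ).prod 𝓘(ℝ, EQ))
      ((𝓘(ℝ, EB).prod 𝓘(ℝ, EG)).prod 𝓘(ℝ, EB)) (reductionMap hπ 𝒜) v.1 v.2⟩,
    AdjointBundle.mk v.1 (𝔄.prodForm v.1 v.2))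

variable (S : ForcedDiscreteSystem EQ Q)

/-- The reduced Lagrangian `L̂_d` on `G̃ × Q/G`, characterized by `L̂_d ∘ Υ = L_d`. -/
def reducedLagrangian : ConjugateBundle hπ × OrbitSpace G Q → ℝ :=
  Function.extend (reductionMap hπ 𝒜) S.lagrangian 0

/-- The reduced force `f̂_d`, a section of `T^*(G̃ × Q/G) ⊕ 𝔤̂^*`, characterized by
`f̂_d(TΥ(v) ⊕ [x, ½(𝔄(v_0) + 𝔄(v_1))]) = f_d(v)` for `v = (v_0, v_1) ∈ T_x(Q × Q)`. -/
def reducedForce (y : ConjugateBundle hπ × OrbitSpace G Q)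
    (δy : TangentSpace ((𝓘(ℝ, EB).prod 𝓘(ℝ, EG)).prod 𝓘(ℝ, EB)) y)
    (c : AdjointBundle EG G Q) : ℝ :=
  Function.extend (reductionTangentMap hπ 𝒜 𝔄) (fun v => S.force v.1 v.2) 0 (⟨y, δy⟩, c)

/-- The component `δv_0 ∈ T G̃` of the variation of `Υ(q_0, q_1)` determined by
`δτ_0`, `δτ_1` and `ξ_0`, `ξ_1`; with `w_0 = 𝒜_d(q_0, q_1)` and `h` the horizontal lift it is
`Tρ(h(δτ_0), T𝒜_d(h(δτ_0), h(δτ_1))) + Tρ((ξ_0)_Q(q_0), T𝒜_d((ξ_0)_Q(q_0), (ξ_1)_Q(q_1)))`. -/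
def conjugateVariation (q₀ q₁ : Q)
    (δτ₀ : TangentSpace 𝓘(ℝ, EB) (orbitProj G q₀)) (δτ₁ : TangentSpace 𝓘(ℝ, EB) (orbitProj G q₁))
    (ξ₀ ξ₁ : GroupLieAlgebra 𝓘(ℝ, EG) G) :
    TangentSpace (𝓘(ℝ, EB).prod 𝓘(ℝ, EG)) (ConjugateBundle.mk hπ (q₀, 𝒜.toFun (q₀, q₁))) :=
  mfderiv (𝓘(ℝ, EQ).prod 𝓘(ℝ, EG)) (𝓘(ℝ, EB).prod 𝓘(ℝ, EG)) (ConjugateBundle.mk hπ)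
      (q₀, 𝒜.toFun (q₀, q₁))
      (𝔄.horizontalLift q₀ δτ₀, mfderiv (𝓘(ℝ, EQ).prod 𝓘(ℝ, EQ)) 𝓘(ℝ, EG) 𝒜.toFun (q₀, q₁)
        (𝔄.horizontalLift q₀ δτ₀, 𝔄.horizontalLift q₁ δτ₁)) +
    mfderiv (𝓘(ℝ, EQ).prod 𝓘(ℝ, EG)) (𝓘(ℝ, EB).prod 𝓘(ℝ, EG)) (ConjugateBundle.mk hπ)
      (q₀, 𝒜.toFun (q₀, q₁))
      (infinitesimalGenerator EQ ξ₀ q₀,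
        mfderiv (𝓘(ℝ, EQ).prod 𝓘(ℝ, EQ)) 𝓘(ℝ, EG) 𝒜.toFun (q₀, q₁)
          (infinitesimalGenerator EQ ξ₀ q₀, infinitesimalGenerator EQ ξ₁ q₁))

/-- A discrete curve `(v_0, τ_1), …, (v_{N-1}, τ_N)` in `G̃ × Q/G` is a trajectory of the reduced
system if it is the image under `Υ` of a discrete curve `q_0, …, q_N` in `Q`, that is
`Υ(q_k, q_{k+1}) = (v_k, τ_{k+1})`, and
`δ(∑ L̂_d(v_k, τ_{k+1})) + ∑ f̂_d(v_k, τ_{k+1})((δv_k, δτ_{k+1}) ⊕ [(q_k, q_{k+1}), ½(ξ_k + ξ_{k+1})])`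
vanishes for all variations `δτ_k ∈ T(Q/G)` and `ξ_k ∈ 𝔤` that vanish for `k = 0` and `k = N`, where
`δv_k` is determined by them. -/
def IsReducedTrajectory {N : ℕ} (y : Fin N → ConjugateBundle hπ × OrbitSpace G Q) : Prop :=
  ∃ q : Fin (N + 1) → Q,
    (∀ k : Fin N, reductionMap hπ 𝒜 (q k.castSucc, q k.succ) = y k) ∧
    ∀ (δτ : ∀ k, TangentSpace 𝓘(ℝ, EB) (orbitProj G (q k)))
      (ξ : Fin (N + 1) → GroupLieAlgebra 𝓘(ℝ, EG) G),
      δτ 0 = 0 → δτ (Fin.last N) = 0 → ξ 0 = 0 → ξ (Fin.last N) = 0 →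
      ∑ k : Fin N, (mfderiv ((𝓘(ℝ, EB).prod 𝓘(ℝ, EG)).prod 𝓘(ℝ, EB)) 𝓘(ℝ, ℝ)
          (reducedLagrangian hπ 𝒜 S) (reductionMap hπ 𝒜 (q k.castSucc, q k.succ))
          (conjugateVariation hπ 𝒜 𝔄 (q k.castSucc) (q k.succ) (δτ k.castSucc) (δτ k.succ)
            (ξ k.castSucc) (ξ k.succ), δτ k.succ) : ℝ) +
        ∑ k : Fin N, reducedForce hπ 𝒜 𝔄 S (reductionMap hπ 𝒜 (q k.castSucc, q k.succ))
          (conjugateVariation hπ 𝒜 𝔄 (q k.castSucc) (q k.succ) (δτ k.castSucc) (δτ k.succ)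
            (ξ k.castSucc) (ξ k.succ), δτ k.succ)
          (AdjointBundle.mk (q k.castSucc, q k.succ)
            ((1 / 2 : ℝ) • (ξ k.castSucc + ξ k.succ))) = 0

/-- `F̂` is the flow of the reduced system: `F̂(v_0, τ_1)` is the unique `(v_1, τ_2)` such that
`(v_0, τ_1), (v_1, τ_2)` is a trajectory of the reduced system. -/
def IsReducedFlow (F : ConjugateBundle hπ × OrbitSpace G Q → ConjugateBundle hπ × OrbitSpace G Q) :
    Prop :=
  ∀ y z, IsReducedTrajectory hπ 𝒜 𝔄 S ![y, z] ↔ F y = z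

end Reduction

end DiscreteReduction

end

open DiscreteReduction

/-!
The map `Υ : Q × Q → G̃ × Q/G` is the quotient map of the diagonal action of `G` on `Q × Q`: the
equivariance of the discrete connection shows that its fibres are exactly the orbits, and `([s(b),
w], τ) ↦ (s(b), w 𝒜_d(s(b), s'(τ))⁻¹ • s'(τ))`, where `s`, `s'` are local sections of `Q → Q/G`,
is a smooth local section of it (`isPrincipalQuotient_reductionMap`). The notion
`IsPrincipalQuotient` records what is used of such a quotient map `p`: invariant smooth maps
descend to smooth maps, the derivative of `p` is surjective, and its kernel consists of the values
of the infinitesimal generators. It applies to `π : Q → Q/G` as well.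

*Poisson structures.* As `G` acts by Poisson maps, `{f ∘ Υ, g ∘ Υ}` is `G`-invariant, hence of the
form `{f, g}_r ∘ Υ`; the axioms for `{·,·}_r` hold because `Υ^*` is injective
(`IsPrincipalQuotient.exists_poissonStructure`). For the same reason a map `F̂` with `F̂ ∘ Υ = Υ ∘
F` is a Poisson map if `F` is one.

*Flows.* The group maps trajectories to trajectories, so that `F` is equivariant and descends to a
map `F̂` with `F̂ ∘ Υ = Υ ∘ F`. It is the flow of the reduced system since the two variational
principles are equivalent (`isReducedTrajectory_iff`): every variation of a curve in `Q` is
uniquely of the form `δq_k = h(δτ_k) + (ξ_k)_Q(q_k)`, the derivative of `Υ` maps `(δq_k,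
δq_{k+1})` to `(δv_k, δτ_{k+1})`, and `½(𝔄(δq_k) + 𝔄(δq_{k+1})) = ½(ξ_k + ξ_{k+1})`, so that both
sums agree term by term. This uses the defining equations of the reduced Lagrangian and of the
reduced force. The latter is well defined because `v ↦ TΥ(v) ⊕ ½(𝔄(v_0) + 𝔄(v_1))` is injective on
each tangent space of `Q × Q` (`reducedForce_reductionMap`).
-/

noncomputable section

open Set
open scoped Topology

set_option linter.unusedSectionVars false

namespace DiscreteReduction

/-! ### Principal quotient maps and Poisson reduction -/

section PrincipalQuotients

variable {EK HK E H E' H' E'' H'' : Type*}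
  [NormedAddCommGroup EK] [NormedSpace ℝ EK] [TopologicalSpace HK]
  [NormedAddCommGroup E] [NormedSpace ℝ E] [TopologicalSpace H]
  [NormedAddCommGroup E'] [NormedSpace ℝ E'] [TopologicalSpace H']
  [NormedAddCommGroup E''] [NormedSpace ℝ E''] [TopologicalSpace H'']
  {J : ModelWithCorners ℝ EK HK} {I : ModelWithCorners ℝ E H} {I' : ModelWithCorners ℝ E' H'}
  {I'' : ModelWithCorners ℝ E'' H''}
  {K M M' M'' : Type*} [Group K] [TopologicalSpace K] [ChartedSpace HK K]
  [TopologicalSpace M] [ChartedSpace H M] [MulAction K M]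
  [TopologicalSpace M'] [ChartedSpace H' M'] [TopologicalSpace M''] [ChartedSpace H'' M'']

variable (I I') in
/-- The derivative of a map of manifolds, as a linear map between the model spaces with which
Mathlib identifies the tangent spaces. Its type does not mention the base points, which can
therefore be rewritten. -/
def modelDeriv (f : M → M') (x : M) : E →L[ℝ] E' := mfderiv I I' f x

lemma modelDeriv_comp {g : M' → M''} {f : M → M'} {x : M} {y : M'}
    (hg : MDifferentiableAt I' I'' g y) (hf : MDifferentiableAt I I' f x) (hy : f x = y) (v : E) :
    modelDeriv I I'' (fun z => g (f z)) x v = modelDeriv I' I'' g y (modelDeriv I I' f x v) := by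
  subst hy
  exact DFunLike.congr_fun (mfderiv_comp x hg hf) v

lemma modelDeriv_congr {f g : M → M'} {x : M} (h : f =ᶠ[𝓝 x] g) :
    modelDeriv I I' f x = modelDeriv I I' g x := h.mfderiv_eq

lemma modelDeriv_id (x : M) (v : E) : modelDeriv I I (fun y : M => y) x v = v :=
  DFunLike.congr_fun (mfderiv_id (I := I) (x := x)) v

lemma modelDeriv_const (c : M') (x : M) : modelDeriv I I' (fun _ : M => c) x = 0 :=
  mfderiv_const

lemma modelDeriv_prodMk {f : M → M'} {g : M → M''} {x : M} (hf : MDifferentiableAt I I' f x)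
    (hg : MDifferentiableAt I I'' g x) (v : E) :
    modelDeriv I (I'.prod I'') (fun y => (f y, g y)) x v =
      (modelDeriv I I' f x v, modelDeriv I I'' g x v) :=
  DFunLike.congr_fun (mfderiv_prodMk hf hg) v

lemma modelDeriv_fst (x : M × M') (v : E × E') :
    modelDeriv (I.prod I') I (fun y : M × M' => y.1) x v = v.1 :=
  DFunLike.congr_fun (mfderiv_fst (I := I) (I' := I') (x := x)) v

lemma modelDeriv_snd (x : M × M') (v : E × E') :
    modelDeriv (I.prod I') I' (fun y : M × M' => y.2) x v = v.2 :=
  DFunLike.congr_fun (mfderiv_snd (I := I) (I' := I') (x := x)) v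

lemma modelDeriv_eq_add {f : M × M' → M''} {x : M} {y : M'}
    (hf : MDifferentiableAt (I.prod I') I'' f (x, y)) (u : E) (v : E') :
    modelDeriv (I.prod I') I'' f (x, y) (u, v) =
      modelDeriv I I'' (fun z => f (z, y)) x u + modelDeriv I' I'' (fun z => f (x, z)) y v :=
  mfderiv_prod_eq_add_apply hf

variable (J I I' K) in
/-- A smooth surjection `p : M → M'` whose fibres are the orbits of `K` and which, near every point
`x` of `M`, has a smooth section `σ` through `x` along which `M` is swept out by the group:
`y = θ(y) • σ(p(y))` for a smooth `K`-valued `θ` with `θ(x) = 1`. -/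
structure IsPrincipalQuotient (p : M → M') : Prop where
  surjective : Function.Surjective p
  contMDiff : ContMDiff I I' ∞ p
  eq_iff : ∀ x y, p x = p y ↔ ∃ g : K, g • x = y
  exists_section : ∀ x, ∃ (θ : M → K) (σ : M' → M), ContMDiffAt I J ∞ θ x ∧
    ContMDiffAt I' I ∞ σ (p x) ∧ θ x = 1 ∧ (∀ᶠ z in 𝓝 (p x), p (σ z) = z) ∧
    ∀ᶠ y in 𝓝 x, θ y • σ (p y) = y

namespace IsPrincipalQuotient

variable {p : M → M'} (hp : IsPrincipalQuotient J I I' K p)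
include hp

lemma map_smul (g : K) (x : M) : p (g • x) = p x := ((hp.eq_iff _ _).2 ⟨g, rfl⟩).symm

lemma contMDiff_of_comp {f : M' → M''} (hf : ContMDiff I I'' ∞ (f ∘ p)) :
    ContMDiff I' I'' ∞ f := by
  intro z
  obtain ⟨x, rfl⟩ := hp.surjective z
  obtain ⟨θ, σ, -, hσ, -, h, -⟩ := hp.exists_section x
  exact ((hf _).comp _ hσ).congr_of_eventuallyEq
    (h.mono fun z hz => by simp only [Function.comp_apply, hz])

/-- A map that is constant on orbits and smooth on `M` descends to a smooth map. -/
lemma exists_contMDiff_comp_eq {F : M → M''} (hF : ContMDiff I I'' ∞ F)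
    (h : ∀ (g : K) x, F (g • x) = F x) :
    ∃ f : M' → M'', ContMDiff I' I'' ∞ f ∧ ∀ x, f (p x) = F x := by
  have hf : ∀ x, F (Function.surjInv hp.surjective (p x)) = F x := fun x => by
    obtain ⟨g, hg⟩ := (hp.eq_iff _ _).1 (Function.surjInv_eq hp.surjective (p x))
    exact (h g _).symm.trans (congrArg F hg)
  refine ⟨fun z => F (Function.surjInv hp.surjective z), hp.contMDiff_of_comp ?_, hf⟩
  rwa [show (fun z => F (Function.surjInv hp.surjective z)) ∘ p = F from funext hf]

lemma mdifferentiableAt (x : M) : MDifferentiableAt I I' p x :=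
  hp.contMDiff.mdifferentiable (by simp) x

lemma modelDeriv_surjective (x : M) : Function.Surjective (modelDeriv I I' p x) := by
  obtain ⟨θ, σ, -, hσ, h1, h, hx⟩ := hp.exists_section x
  have hσx : σ (p x) = x := by simpa [h1] using hx.self_of_nhds
  have hd : MDifferentiableAt I' I σ (p x) := hσ.mdifferentiableAt (by simp)
  refine fun u => ⟨modelDeriv I' I σ (p x) u, ?_⟩
  rw [← modelDeriv_comp (hp.mdifferentiableAt x) hd hσx, modelDeriv_congr (g := fun z => z) h,
    modelDeriv_id]

/-- Differentiating `y = θ(y) • σ(p(y))` shows that vertical vectors are values of infinitesimal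
generators. -/
lemma exists_generator_of_modelDeriv_eq_zero [ContMDiffSMul J I ∞ K M] {x : M} {v : E}
    (hv : modelDeriv I I' p x v = 0) : ∃ ξ : EK, modelDeriv J I (fun g : K => g • x) 1 ξ = v := by
  obtain ⟨θ, σ, hθ, hσ, h1, -, hx⟩ := hp.exists_section x
  have hσx : σ (p x) = x := by simpa [h1] using hx.self_of_nhds
  have hd : MDifferentiableAt I' I σ (p x) := hσ.mdifferentiableAt (by simp)
  have hdθ : MDifferentiableAt I J θ x := hθ.mdifferentiableAt (by simp)
  have hdσ : MDifferentiableAt I I (fun y => σ (p y)) x := hd.comp x (hp.mdifferentiableAt x)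
  have hs : MDifferentiableAt (J.prod I) I (fun q : K × M => q.1 • q.2) (1, x) :=
    (contMDiff_smul (n := ∞)).mdifferentiable (by simp) _
  refine ⟨modelDeriv I J θ x v, ?_⟩
  have key : modelDeriv I I (fun y => θ y • σ (p y)) x v = v := by
    rw [modelDeriv_congr (g := fun y => y) hx, modelDeriv_id]
  rwa [modelDeriv_comp (f := fun y => (θ y, σ (p y))) hs (hdθ.prodMk hdσ) (by simp [h1, hσx]),
    modelDeriv_prodMk hdθ hdσ, modelDeriv_comp hd (hp.mdifferentiableAt x) rfl, hv, map_zero,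
    modelDeriv_eq_add hs, map_zero, add_zero] at key

lemma modelDeriv_generator [ContMDiffSMul J I ∞ K M] (x : M) (ξ : EK) :
    modelDeriv I I' p x (modelDeriv J I (fun g : K => g • x) 1 ξ) = 0 := by
  have hs : MDifferentiableAt J I (fun g : K => g • x) 1 :=
    ((contMDiff_smul (I := J) (I' := I) (n := ∞) (G := K) (M := M)).comp
      (contMDiff_id.prodMk contMDiff_const)).mdifferentiable (by simp) _
  rw [← modelDeriv_comp (hp.mdifferentiableAt x) hs (one_smul K x),
    show (fun g : K => p (g • x)) = fun _ => p x from funext fun g => hp.map_smul g x,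
    modelDeriv_const]
  rfl

/-- Poisson reduction: if the group acts by Poisson maps, the bracket of two functions on the
quotient is the function to which the bracket of their pullbacks descends. -/
theorem exists_poissonStructure (P : PoissonStructure I M)
    (hG : ∀ g : K, IsPoissonMap P P (fun x : M => g • x)) :
    ∃ Pr : PoissonStructure I' M', IsPoissonMap P Pr p := by
  let pb (f : C^∞⟮I', M'; ℝ⟯) : C^∞⟮I, M; ℝ⟯ := f.comp ⟨p, hp.contMDiff⟩
  have hex : ∀ f g : C^∞⟮I', M'; ℝ⟯, ∃ k : C^∞⟮I', M'; ℝ⟯, pb k = P.bracket (pb f) (pb g) := by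
    intro f g
    obtain ⟨k, hk, hk'⟩ := hp.exists_contMDiff_comp_eq (P.bracket (pb f) (pb g)).contMDiff
      (fun a x => by
        obtain ⟨ha, h⟩ := hG a
        have hf : ∀ f, (pb f).comp ⟨fun x => a • x, ha⟩ = pb f := fun f => by
          ext x
          exact congrArg f (hp.map_smul a x)
        have := h (pb f) (pb g)
        rw [hf, hf] at this
        exact DFunLike.congr_fun this x)
    exact ⟨⟨k, hk⟩, by ext x; exact hk' x⟩
  choose br hbr using hex
  have hinj : ∀ {f g}, pb f = pb g → f = g := fun {f g} h => by
    ext z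
    obtain ⟨x, rfl⟩ := hp.surjective z
    exact DFunLike.congr_fun h x
  have hadd : ∀ f g, pb (f + g) = pb f + pb g := fun _ _ => rfl
  have hmul : ∀ f g, pb (f * g) = pb f * pb g := fun _ _ => rfl
  have hneg : ∀ f, pb (-f) = -pb f := fun _ => rfl
  have hsmul : ∀ (c : ℝ) f, pb (c • f) = c • pb f := fun _ _ => rfl
  have hzero : pb 0 = 0 := rfl
  refine ⟨⟨LinearMap.mk₂ ℝ br ?_ ?_ ?_ ?_, ?_, ?_, ?_⟩, hp.contMDiff, hbr⟩
  · exact fun f f' g => hinj (by simp [hadd, hbr])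
  · exact fun c f g => hinj (by simp [hsmul, hbr])
  · exact fun f g g' => hinj (by simp [hadd, hbr])
  · exact fun c f g => hinj (by simp [hsmul, hbr])
  · exact fun f g => hinj (by
      simp only [LinearMap.mk₂_apply, hneg, hbr]
      exact P.skew _ _)
  · exact fun f g h => hinj (by
      simp only [LinearMap.mk₂_apply, hadd, hbr, hzero]
      exact P.jacobi _ _ _)
  · exact fun f g h => hinj (by
      simp only [LinearMap.mk₂_apply, hadd, hmul, hbr]
      exact P.leibniz _ _ _)

lemma isPoissonMap_of_comp {P : PoissonStructure I M} {P' : PoissonStructure I' M'}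
    {P'' : PoissonStructure I'' M''} (h : IsPoissonMap P P' p) {f : M' → M''}
    (hf : IsPoissonMap P P'' (f ∘ p)) : IsPoissonMap P' P'' f := by
  obtain ⟨_, h⟩ := h
  obtain ⟨hfp, hf⟩ := hf
  have hfs := hp.contMDiff_of_comp hfp
  refine ⟨hfs, fun a b => ?_⟩
  ext z
  obtain ⟨x, rfl⟩ := hp.surjective z
  exact (DFunLike.congr_fun (hf a b) x).trans
    (DFunLike.congr_fun (h (a.comp ⟨f, hfs⟩) (b.comp ⟨f, hfs⟩)) x).symm

end IsPrincipalQuotient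

lemma IsPoissonMap.contMDiff {P : PoissonStructure I M} {P' : PoissonStructure I' M'}
    {f : M → M'} (hf : IsPoissonMap P P' f) : ContMDiff I I' ∞ f := hf.1

lemma IsPoissonMap.comp {P : PoissonStructure I M} {P' : PoissonStructure I' M'}
    {P'' : PoissonStructure I'' M''} {g : M' → M''} {f : M → M'} (hg : IsPoissonMap P' P'' g)
    (hf : IsPoissonMap P P' f) : IsPoissonMap P P'' (g ∘ f) := by
  obtain ⟨hgs, h⟩ := hg
  obtain ⟨hfs, h'⟩ := hf
  refine ⟨hgs.comp hfs, fun a b => ?_⟩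
  ext x
  exact (DFunLike.congr_fun (h a b) (f x)).trans
    (DFunLike.congr_fun (h' (a.comp ⟨g, hgs⟩) (b.comp ⟨g, hgs⟩)) x)

end PrincipalQuotients

/-! ### The quotient maps of `Q` and `Q × Q` -/

variable {EQ EG EB : Type*}
  [NormedAddCommGroup EQ] [NormedSpace ℝ EQ]
  [NormedAddCommGroup EG] [NormedSpace ℝ EG]
  [NormedAddCommGroup EB] [NormedSpace ℝ EB]
  {G Q : Type*} [TopologicalSpace G] [ChartedSpace EG G] [Group G]
  [TopologicalSpace Q] [ChartedSpace EQ Q] [MulAction G Q]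
  [ChartedSpace EB (OrbitSpace G Q)]

section OrbitMaps

namespace EquivariantTrivialization

variable (e : EquivariantTrivialization EQ EG EB G Q)

lemma mem_source_iff {q : Q} : q ∈ e.source ↔ orbitProj G q ∈ e.baseSet := by
  rw [e.source_eq]; rfl

lemma contMDiffAt_snd {q : Q} (hq : orbitProj G q ∈ e.baseSet) :
    ContMDiffAt 𝓘(ℝ, EQ) 𝓘(ℝ, EG) ∞ (fun y => (e.toOpenPartialHomeomorph y).2) q :=
  contMDiff_snd.contMDiffAt.comp q
    (e.contMDiffOn_coe.contMDiffAt (e.open_source.mem_nhds (e.mem_source_iff.2 hq)))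

lemma contMDiffAt_symm_one {b : OrbitSpace G Q} (hb : b ∈ e.baseSet) :
    ContMDiffAt 𝓘(ℝ, EB) 𝓘(ℝ, EQ) ∞ (fun b => e.toOpenPartialHomeomorph.symm (b, 1)) b :=
  ContMDiffAt.comp (x := b) (f := fun b => (b, (1 : G)))
    (e.contMDiffOn_symm.contMDiffAt (e.open_target.mem_nhds
      (by rw [e.target_eq]; exact ⟨hb, mem_univ _⟩)))
    (contMDiffAt_id.prodMk contMDiffAt_const)

end EquivariantTrivialization

variable (hπ : IsPrincipalBundle EQ EG EB G Q)

include hπ in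
/-- The action is free, as it is on the trivial bundle. -/
lemma IsPrincipalBundle.smul_left_injective (q : Q) : Function.Injective (fun g : G => g • q) := by
  intro g h hgh
  obtain ⟨e, he⟩ := hπ.exists_trivialization (orbitProj G q)
  have hq := e.mem_source_iff.2 he
  have h1 := congrArg (fun y => (e.toOpenPartialHomeomorph y).2) hgh
  simp only [e.coe_smul_snd _ _ hq] at h1
  exact mul_right_cancel h1

include hπ in
lemma IsPrincipalBundle.contMDiff_orbitProj :
    ContMDiff 𝓘(ℝ, EQ) 𝓘(ℝ, EB) ∞ (orbitProj G : Q → OrbitSpace G Q) := by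
  intro q
  obtain ⟨e, he⟩ := hπ.exists_trivialization (orbitProj G q)
  have hq := e.open_source.mem_nhds (e.mem_source_iff.2 he)
  exact (contMDiff_fst.contMDiffAt.comp q (e.contMDiffOn_coe.contMDiffAt hq)).congr_of_eventuallyEq
    (Filter.eventually_of_mem hq fun y hy => (e.coe_fst y hy).symm)

variable [LieGroup 𝓘(ℝ, EG) ∞ G] [ContMDiffSMul 𝓘(ℝ, EG) 𝓘(ℝ, EQ) ∞ G Q]

include hπ in
theorem IsPrincipalBundle.isPrincipalQuotient_orbitProj :
    IsPrincipalQuotient 𝓘(ℝ, EG) 𝓘(ℝ, EQ) 𝓘(ℝ, EB) G (orbitProj G : Q → OrbitSpace G Q) where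
  surjective := Quotient.mk_surjective
  contMDiff := hπ.contMDiff_orbitProj
  eq_iff x y := by
    rw [eq_comm]
    exact Quotient.eq.trans MulAction.orbitRel_apply
  exists_section x := by
    obtain ⟨e, he⟩ := hπ.exists_trivialization (orbitProj G x)
    refine ⟨fun y => (e.toOpenPartialHomeomorph y).2 * (e.toOpenPartialHomeomorph x).2⁻¹,
      fun b => (e.toOpenPartialHomeomorph x).2 • e.toOpenPartialHomeomorph.symm (b, 1),
      (e.contMDiffAt_snd he).mul contMDiffAt_const,
      (ContMDiffSMul.contMDiff_const_smul (I := 𝓘(ℝ, EG)) _).contMDiffAt.comp _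
        (e.contMDiffAt_symm_one he), mul_inv_cancel _, ?_, ?_⟩
    · filter_upwards [e.open_baseSet.mem_nhds he] with b hb
      rw [orbitProj_smul, e.orbitProj_symm hb]
    · filter_upwards [continuous_orbitProj.continuousAt.eventually (e.open_baseSet.mem_nhds he)]
        with y hy
      rw [e.symm_one hy, smul_smul, smul_smul, inv_mul_cancel_right, mul_inv_cancel, one_smul]

namespace ConjugateBundle

variable [IsManifold 𝓘(ℝ, EQ) ∞ Q] [IsManifold 𝓘(ℝ, EB) ∞ (OrbitSpace G Q)]

/-- The charts of `G̃` may use any local trivialization, not only the chosen one at a point. -/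
lemma localTriv_trans_mem_maximalAtlas (e : EquivariantTrivialization EQ EG EB G Q)
    (y : OrbitSpace G Q × G) :
    localTriv hπ e ≫ₕ chartAt (ModelProd EB EG) y ∈
      IsManifold.maximalAtlas (𝓘(ℝ, EB).prod 𝓘(ℝ, EG)) ∞ (ConjugateBundle hπ) :=
  StructureGroupoid.subset_maximalAtlas _
    ⟨localTriv hπ e, mem_range_self e, chartAt _ y, chart_mem_atlas _ y, rfl⟩

lemma contMDiffAt_localTriv (e : EquivariantTrivialization EQ EG EB G Q) {z : ConjugateBundle hπ}
    (hz : proj hπ z ∈ e.baseSet) :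
    ContMDiffAt (𝓘(ℝ, EB).prod 𝓘(ℝ, EG)) (𝓘(ℝ, EB).prod 𝓘(ℝ, EG)) ∞ (localTriv hπ e) z := by
  set c := chartAt (ModelProd EB EG) (localTriv hπ e z)
  have hz' : z ∈ (localTriv hπ e ≫ₕ c).source :=
    ⟨hz, mem_chart_source (ModelProd EB EG) (localTriv hπ e z)⟩
  have h1 := (contMDiffOn_of_mem_maximalAtlas
    (localTriv_trans_mem_maximalAtlas hπ e (localTriv hπ e z))).contMDiffAt
    ((localTriv hπ e ≫ₕ c).open_source.mem_nhds hz')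
  have h2 : ContMDiffAt (𝓘(ℝ, EB).prod 𝓘(ℝ, EG)) (𝓘(ℝ, EB).prod 𝓘(ℝ, EG)) ∞ c.symm
      ((localTriv hπ e ≫ₕ c) z) :=
    (contMDiffOn_chart_symm (x := localTriv hπ e z)).contMDiffAt
      (c.open_target.mem_nhds (c.map_source (mem_chart_source _ _)))
  refine (h2.comp z h1).congr_of_eventuallyEq ?_
  filter_upwards [(localTriv hπ e ≫ₕ c).open_source.mem_nhds hz'] with y hy
  exact (c.left_inv hy.2).symm

lemma contMDiffAt_localTriv_symm (e : EquivariantTrivialization EQ EG EB G Q)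
    {y : OrbitSpace G Q × G} (hy : y.1 ∈ e.baseSet) :
    ContMDiffAt (𝓘(ℝ, EB).prod 𝓘(ℝ, EG)) (𝓘(ℝ, EB).prod 𝓘(ℝ, EG)) ∞ (localTriv hπ e).symm y := by
  set c := chartAt (ModelProd EB EG) y
  have hyt : y ∈ (localTriv hπ e).target := ⟨hy, mem_univ _⟩
  have hyc : y ∈ c.source := mem_chart_source _ _
  have h1 : ContMDiffAt (𝓘(ℝ, EB).prod 𝓘(ℝ, EG)) (𝓘(ℝ, EB).prod 𝓘(ℝ, EG)) ∞ c y :=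
    contMDiffAt_of_mem_maximalAtlas (IsManifold.chart_mem_maximalAtlas y) hyc
  have hct : c y ∈ (localTriv hπ e ≫ₕ c).target := by
    refine ⟨c.map_source hyc, ?_⟩
    rw [mem_preimage, c.left_inv hyc]
    exact hyt
  have h2 := (contMDiffOn_symm_of_mem_maximalAtlas
    (localTriv_trans_mem_maximalAtlas hπ e y)).contMDiffAt
    ((localTriv hπ e ≫ₕ c).open_target.mem_nhds hct)
  refine (h2.comp y h1).congr_of_eventuallyEq ?_
  filter_upwards [c.open_source.mem_nhds hyc] with w hw
  exact congrArg (localTriv hπ e).symm (c.left_inv hw).symm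

lemma contMDiff_mk :
    ContMDiff (𝓘(ℝ, EQ).prod 𝓘(ℝ, EG)) (𝓘(ℝ, EB).prod 𝓘(ℝ, EG)) ∞ (mk hπ) := by
  rintro ⟨q, w⟩
  obtain ⟨e, he⟩ := hπ.exists_trivialization (orbitProj G q)
  have h1 : ContMDiffAt (𝓘(ℝ, EQ).prod 𝓘(ℝ, EG)) 𝓘(ℝ, EG) ∞
      (fun p : Q × G => (e.toOpenPartialHomeomorph p.1).2) (q, w) :=
    ContMDiffAt.comp (g := fun q => (e.toOpenPartialHomeomorph q).2) (q, w) (e.contMDiffAt_snd he)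
      contMDiffAt_fst
  have h2 : ContMDiffAt (𝓘(ℝ, EQ).prod 𝓘(ℝ, EG)) (𝓘(ℝ, EB).prod 𝓘(ℝ, EG)) ∞
      (fun p : Q × G => (orbitProj G p.1, (e.toOpenPartialHomeomorph p.1).2⁻¹ * p.2 *
        (e.toOpenPartialHomeomorph p.1).2)) (q, w) :=
    (hπ.contMDiff_orbitProj.contMDiffAt.comp (q, w) contMDiffAt_fst).prodMk
      ((h1.inv.mul contMDiffAt_snd).mul h1)
  refine (ContMDiffAt.comp (q, w) (contMDiffAt_localTriv_symm hπ e he) h2).congr_of_eventuallyEq ?_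
  filter_upwards [(continuous_orbitProj.comp continuous_fst).continuousAt.eventually
    (e.open_baseSet.mem_nhds he)] with p hp
  have := (localTriv hπ e).left_inv (x := mk hπ p) hp
  rw [← this]
  exact congrArg (fun w => (localTriv hπ e).symm (orbitProj G p.1, w)) (fibreCoord_mk hπ e hp p.2)

lemma contMDiff_proj :
    ContMDiff (𝓘(ℝ, EB).prod 𝓘(ℝ, EG)) 𝓘(ℝ, EB) ∞ (proj hπ) := by
  intro z
  obtain ⟨e, he⟩ := hπ.exists_trivialization (proj hπ z)
  exact contMDiff_fst.contMDiffAt.comp z (contMDiffAt_localTriv hπ e he)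

lemma contMDiffAt_fibreCoord (e : EquivariantTrivialization EQ EG EB G Q) {z : ConjugateBundle hπ}
    (hz : proj hπ z ∈ e.baseSet) :
    ContMDiffAt (𝓘(ℝ, EB).prod 𝓘(ℝ, EG)) 𝓘(ℝ, EG) ∞ (fibreCoord hπ e) z :=
  contMDiff_snd.contMDiffAt.comp z (contMDiffAt_localTriv hπ e hz)

end ConjugateBundle

variable [IsManifold 𝓘(ℝ, EQ) ∞ Q] (𝒜 : AffineDiscreteConnection EQ EG G Q)

lemma AffineDiscreteConnection.toFun_smul_smul (g : G) (x : Q × Q) :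
    𝒜.toFun (g • x) = g * 𝒜.toFun x * g⁻¹ := 𝒜.toFun_smul x.1 x.2 g g

lemma AffineDiscreteConnection.toFun_smul_right (g : G) (q₀ q₁ : Q) :
    𝒜.toFun (q₀, g • q₁) = g * 𝒜.toFun (q₀, q₁) := by
  simpa using 𝒜.toFun_smul q₀ q₁ 1 g

lemma reductionMap_eq_iff (x y : Q × Q) :
    reductionMap hπ 𝒜 x = reductionMap hπ 𝒜 y ↔ ∃ g : G, g • x = y := by
  constructor
  · intro h
    obtain ⟨h1, h2⟩ := Prod.ext_iff.1 h
    obtain ⟨g, hg⟩ := (ConjugateBundle.mk_eq_iff hπ).1 h1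
    obtain ⟨k, hk⟩ := (hπ.isPrincipalQuotient_orbitProj.eq_iff _ _).1 h2
    obtain ⟨x₀, x₁⟩ := x
    obtain ⟨y₀, y₁⟩ := y
    obtain ⟨rfl, hw⟩ := Prod.ext_iff.1 hg
    dsimp only at hk hw
    subst hk
    rw [𝒜.toFun_smul] at hw
    -- the discrete connection detects that both points are moved by the same group element
    have : g = k := mul_right_cancel (mul_right_cancel hw)
    exact ⟨g, by rw [this]; rfl⟩
  · rintro ⟨g, rfl⟩
    refine Prod.ext ?_ (orbitProj_smul g x.2).symm
    change ConjugateBundle.mk hπ _ = ConjugateBundle.mk hπ _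
    rw [𝒜.toFun_smul_smul]
    exact (ConjugateBundle.mk_smul hπ g x.1 _).symm

variable [IsManifold 𝓘(ℝ, EB) ∞ (OrbitSpace G Q)]

lemma contMDiff_reductionMap :
    ContMDiff (𝓘(ℝ, EQ).prod 𝓘(ℝ, EQ)) ((𝓘(ℝ, EB).prod 𝓘(ℝ, EG)).prod 𝓘(ℝ, EB)) ∞
      (reductionMap hπ 𝒜) :=
  ((ConjugateBundle.contMDiff_mk hπ).comp (contMDiff_fst.prodMk 𝒜.contMDiff_toFun)).prodMk
    (hπ.contMDiff_orbitProj.comp contMDiff_snd)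

/-- The map `Υ` is the quotient map of the diagonal action on `Q × Q`. If `s` and `s'` are the
unit sections of trivializations of `Q`, then `([s(b), w], τ) ↦ (s(b), w 𝒜_d(s(b), s'(τ))⁻¹ •
s'(τ))` is a local section of `Υ`. -/
theorem isPrincipalQuotient_reductionMap :
    IsPrincipalQuotient 𝓘(ℝ, EG) (𝓘(ℝ, EQ).prod 𝓘(ℝ, EQ))
      ((𝓘(ℝ, EB).prod 𝓘(ℝ, EG)).prod 𝓘(ℝ, EB)) G (reductionMap hπ 𝒜) where
  surjective := by
    rintro ⟨z, τ⟩
    obtain ⟨⟨q, w⟩, rfl⟩ := ConjugateBundle.mk_surjective hπ z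
    obtain ⟨q', rfl⟩ := hπ.isPrincipalQuotient_orbitProj.surjective τ
    refine ⟨(q, (w * (𝒜.toFun (q, q'))⁻¹) • q'), ?_⟩
    rw [reductionMap, 𝒜.toFun_smul_right, inv_mul_cancel_right, orbitProj_smul]
  contMDiff := contMDiff_reductionMap hπ 𝒜
  eq_iff := reductionMap_eq_iff hπ 𝒜
  exists_section x := by
    obtain ⟨e, he⟩ := hπ.exists_trivialization (orbitProj G x.1)
    obtain ⟨e', he'⟩ := hπ.exists_trivialization (orbitProj G x.2)
    let s (b : OrbitSpace G Q) : Q := e.toOpenPartialHomeomorph.symm (b, 1)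
    let s' (b : OrbitSpace G Q) : Q := e'.toOpenPartialHomeomorph.symm (b, 1)
    let σ (z : ConjugateBundle hπ × OrbitSpace G Q) : Q × Q :=
      (s (z.1.proj hπ), (z.1.fibreCoord hπ e *
        (𝒜.toFun (s (z.1.proj hπ), s' z.2))⁻¹) • s' z.2)
    have hσ : ∀ z, z.1.proj hπ ∈ e.baseSet → z.2 ∈ e'.baseSet → reductionMap hπ 𝒜 (σ z) = z := by
      intro z hz hz'
      refine Prod.ext ?_ ((orbitProj_smul _ _).trans (e'.orbitProj_symm hz' 1))
      change ConjugateBundle.mk hπ (_, 𝒜.toFun (_, _)) = _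
      rw [𝒜.toFun_smul_right, inv_mul_cancel_right]
      exact (ConjugateBundle.localTriv hπ e).left_inv hz
    let φ (q : Q) : G := (e.toOpenPartialHomeomorph q).2
    have hc : ContMDiffAt ((𝓘(ℝ, EB).prod 𝓘(ℝ, EG)).prod 𝓘(ℝ, EB)) (𝓘(ℝ, EQ).prod 𝓘(ℝ, EQ)) ∞ σ
        (reductionMap hπ 𝒜 x) := by
      have h1 : ContMDiffAt ((𝓘(ℝ, EB).prod 𝓘(ℝ, EG)).prod 𝓘(ℝ, EB)) 𝓘(ℝ, EQ) ∞
          (fun z : ConjugateBundle hπ × OrbitSpace G Q => s (z.1.proj hπ))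
          (reductionMap hπ 𝒜 x) :=
        ContMDiffAt.comp (g := s) (reductionMap hπ 𝒜 x) (e.contMDiffAt_symm_one he)
          (((ConjugateBundle.contMDiff_proj hπ).comp contMDiff_fst).contMDiffAt)
      have h2 : ContMDiffAt ((𝓘(ℝ, EB).prod 𝓘(ℝ, EG)).prod 𝓘(ℝ, EB)) 𝓘(ℝ, EQ) ∞
          (fun z : ConjugateBundle hπ × OrbitSpace G Q => s' z.2) (reductionMap hπ 𝒜 x) :=
        ContMDiffAt.comp (g := s') (reductionMap hπ 𝒜 x) (e'.contMDiffAt_symm_one he')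
          contMDiffAt_snd
      have h3 : ContMDiffAt ((𝓘(ℝ, EB).prod 𝓘(ℝ, EG)).prod 𝓘(ℝ, EB)) 𝓘(ℝ, EG) ∞
          (fun z : ConjugateBundle hπ × OrbitSpace G Q => z.1.fibreCoord hπ e)
          (reductionMap hπ 𝒜 x) :=
        ContMDiffAt.comp (reductionMap hπ 𝒜 x)
          (ConjugateBundle.contMDiffAt_fibreCoord hπ e (z := (reductionMap hπ 𝒜 x).1) he)
          contMDiffAt_fst
      have h4 := 𝒜.contMDiff_toFun.contMDiffAt.comp (reductionMap hπ 𝒜 x) (h1.prodMk h2)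
      exact h1.prodMk ((contMDiff_smul (n := ∞)).contMDiffAt.comp (reductionMap hπ 𝒜 x)
        ((h3.mul h4.inv).prodMk h2))
    have hr : ∀ᶠ z in 𝓝 (reductionMap hπ 𝒜 x), z.1.proj hπ ∈ e.baseSet ∧ z.2 ∈ e'.baseSet :=
      Filter.inter_mem ((e.open_baseSet.preimage ((ConjugateBundle.continuous_proj hπ).comp
        continuous_fst)).mem_nhds (show reductionMap hπ 𝒜 x ∈ _ from he))
        ((e'.open_baseSet.preimage continuous_snd).mem_nhds (show reductionMap hπ 𝒜 x ∈ _ from he'))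
    refine ⟨fun y => φ y.1 * (φ x.1)⁻¹, fun z => φ x.1 • σ z,
      (ContMDiffAt.comp (g := φ) x (e.contMDiffAt_snd he) contMDiffAt_fst).mul contMDiffAt_const,
      (ContMDiffSMul.contMDiff_const_smul (I := 𝓘(ℝ, EG)) _).contMDiffAt.comp _ hc,
      mul_inv_cancel _, ?_, ?_⟩
    · filter_upwards [hr] with z hz
      rw [(reductionMap_eq_iff hπ 𝒜 _ _).2 ⟨(φ x.1)⁻¹, inv_smul_smul _ (σ z)⟩, hσ z hz.1 hz.2]
    · filter_upwards [(contMDiff_reductionMap hπ 𝒜).continuous.continuousAt.eventually hr]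
        with y hy
      -- by freeness, the point of an orbit is determined by its first component
      obtain ⟨g, hg⟩ := (reductionMap_eq_iff hπ 𝒜 _ _).1 (hσ _ hy.1 hy.2).symm
      have h1 : g • y.1 = (φ y.1)⁻¹ • y.1 :=
        (congrArg Prod.fst hg).trans (e.symm_one hy.1)
      rw [← hg, hπ.smul_left_injective _ h1, smul_smul, smul_smul, inv_mul_cancel_right,
        mul_inv_cancel, one_smul]

end OrbitMaps

/-! ### Horizontal and vertical variations, and the reduced system -/

section Variations

variable (EQ G) in
/-- The infinitesimal generators at `q`, as a linear map `𝔤 → T_q Q` between model spaces. -/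
def generatorMap (q : Q) : EG →L[ℝ] EQ :=
  modelDeriv 𝓘(ℝ, EG) 𝓘(ℝ, EQ) (fun g : G => g • q) 1

lemma modelDeriv_prod_smul {g : G} (hg : ∀ q, MDifferentiableAt 𝓘(ℝ, EQ) 𝓘(ℝ, EQ)
    (fun y : Q => g • y) q) (x : Q × Q) (v : EQ × EQ) :
    modelDeriv (𝓘(ℝ, EQ).prod 𝓘(ℝ, EQ)) (𝓘(ℝ, EQ).prod 𝓘(ℝ, EQ)) (fun y : Q × Q => g • y) x v =
      (modelDeriv 𝓘(ℝ, EQ) 𝓘(ℝ, EQ) (fun y : Q => g • y) x.1 v.1,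
        modelDeriv 𝓘(ℝ, EQ) 𝓘(ℝ, EQ) (fun y : Q => g • y) x.2 v.2) := by
  refine (modelDeriv_prodMk (f := fun y : Q × Q => g • y.1) (g := fun y : Q × Q => g • y.2)
    ((hg x.1).comp x mdifferentiableAt_fst) ((hg x.2).comp x mdifferentiableAt_snd) v).trans ?_
  rw [modelDeriv_comp (hg x.1) mdifferentiableAt_fst rfl, modelDeriv_fst,
    modelDeriv_comp (hg x.2) mdifferentiableAt_snd rfl, modelDeriv_snd]

variable [LieGroup 𝓘(ℝ, EG) ∞ G] [ContMDiffSMul 𝓘(ℝ, EG) 𝓘(ℝ, EQ) ∞ G Q]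

lemma mdifferentiableAt_smul_left (q : Q) (g : G) :
    MDifferentiableAt 𝓘(ℝ, EG) 𝓘(ℝ, EQ) (fun g : G => g • q) g :=
  ((contMDiff_smul (I := 𝓘(ℝ, EG)) (I' := 𝓘(ℝ, EQ)) (n := ∞) (G := G) (M := Q)).comp
    (contMDiff_id.prodMk contMDiff_const)).mdifferentiable (by simp) _

lemma modelDeriv_prod_smul_left (x : Q × Q) (ξ : EG) :
    modelDeriv 𝓘(ℝ, EG) (𝓘(ℝ, EQ).prod 𝓘(ℝ, EQ)) (fun g : G => g • x) 1 ξ =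
      (generatorMap EQ G x.1 ξ, generatorMap EQ G x.2 ξ) :=
  modelDeriv_prodMk (mdifferentiableAt_smul_left x.1 1) (mdifferentiableAt_smul_left x.2 1) ξ

variable [IsManifold 𝓘(ℝ, EQ) ∞ Q]

namespace PrincipalConnection

variable (𝔄 : PrincipalConnection EQ EG G Q)

/-- The connection form at `q`, as a linear map `T_q Q → 𝔤` between model spaces. -/
def modelForm (q : Q) : EQ →L[ℝ] EG := 𝔄.form q

/-- The horizontal lift to `T_q Q`, as a map between model spaces. -/
def modelLift (q : Q) (u : EB) : EQ := 𝔄.horizontalLift q u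

lemma modelForm_generatorMap (q : Q) (ξ : EG) : 𝔄.modelForm q (generatorMap EQ G q ξ) = ξ :=
  𝔄.form_generator ξ q

lemma prodForm_eq (x : Q × Q) (v : EQ × EQ) :
    𝔄.prodForm x v = (1 / 2 : ℝ) • (𝔄.modelForm x.1 v.1 + 𝔄.modelForm x.2 v.2) := rfl

lemma prodForm_sub (x : Q × Q) (u v : EQ × EQ) :
    (𝔄.prodForm x (u - v : EQ × EQ) : EG) = (𝔄.prodForm x u : EG) - (𝔄.prodForm x v : EG) := by
  change (1 / 2 : ℝ) • (𝔄.modelForm x.1 (u.1 - v.1) + 𝔄.modelForm x.2 (u.2 - v.2)) =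
    (1 / 2 : ℝ) • (𝔄.modelForm x.1 u.1 + 𝔄.modelForm x.2 u.2) -
      (1 / 2 : ℝ) • (𝔄.modelForm x.1 v.1 + 𝔄.modelForm x.2 v.2)
  rw [map_sub, map_sub]
  module

lemma prodForm_smul (g : G) (x : Q × Q) (v : EQ × EQ) :
    𝔄.prodForm (g • x) (modelDeriv (𝓘(ℝ, EQ).prod 𝓘(ℝ, EQ)) (𝓘(ℝ, EQ).prod 𝓘(ℝ, EQ))
      (fun y : Q × Q => g • y) x v) = adjointAction g (𝔄.prodForm x v) := by
  rw [modelDeriv_prod_smul fun q => (ContMDiffSMul.contMDiff_const_smul (I := 𝓘(ℝ, EG))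
    (n := ∞) g).mdifferentiable (by simp) q]
  let Ad : EG →L[ℝ] EG := modelDeriv 𝓘(ℝ, EG) 𝓘(ℝ, EG) (fun h : G => g * h * g⁻¹) 1
  have h (q : Q) (u : EQ) : 𝔄.modelForm (g • q)
      (modelDeriv 𝓘(ℝ, EQ) 𝓘(ℝ, EQ) (fun y : Q => g • y) q u) = Ad (𝔄.modelForm q u) :=
    𝔄.form_smul g q u
  change (1 / 2 : ℝ) • (𝔄.modelForm (g • x.1) _ + 𝔄.modelForm (g • x.2) _) =
    Ad ((1 / 2 : ℝ) • (𝔄.modelForm x.1 v.1 + 𝔄.modelForm x.2 v.2))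
  rw [h, h, ← map_add, ← map_smul]

variable (hπ : IsPrincipalBundle EQ EG EB G Q)
include hπ

lemma eq_zero_of_vertical_of_horizontal {q : Q} {v : EQ}
    (h1 : modelDeriv 𝓘(ℝ, EQ) 𝓘(ℝ, EB) (orbitProj G) q v = 0) (h2 : 𝔄.modelForm q v = 0) :
    v = 0 := by
  obtain ⟨ξ, rfl⟩ :=
    hπ.isPrincipalQuotient_orbitProj.exists_generator_of_modelDeriv_eq_zero h1
  rw [← 𝔄.modelForm_generatorMap q ξ, show 𝔄.modelForm q (generatorMap EQ G q ξ) = 0 from h2,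
    map_zero]

/-- The horizontal lift exists: a preimage under `Tπ` becomes horizontal once its vertical part is
subtracted. -/
lemma modelLift_spec (q : Q) (u : EB) :
    modelDeriv 𝓘(ℝ, EQ) 𝓘(ℝ, EB) (orbitProj G) q (𝔄.modelLift q u) = u ∧
      𝔄.modelForm q (𝔄.modelLift q u) = 0 := by
  have hex : ∃ v : EQ, modelDeriv 𝓘(ℝ, EQ) 𝓘(ℝ, EB) (orbitProj G) q v = u ∧
      𝔄.modelForm q v = 0 := by
    obtain ⟨v, hv⟩ := hπ.isPrincipalQuotient_orbitProj.modelDeriv_surjective q u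
    refine ⟨v - generatorMap EQ G q (𝔄.modelForm q v), ?_, ?_⟩
    · rw [map_sub, hv, generatorMap, hπ.isPrincipalQuotient_orbitProj.modelDeriv_generator,
        sub_zero]
    · rw [map_sub, 𝔄.modelForm_generatorMap, sub_self]
  exact Classical.epsilon_spec hex

/-- The decomposition of a tangent vector into its horizontal and vertical parts. -/
lemma modelLift_add_generatorMap (q : Q) (v : EQ) :
    𝔄.modelLift q (modelDeriv 𝓘(ℝ, EQ) 𝓘(ℝ, EB) (orbitProj G : Q → OrbitSpace G Q) q v) +
      generatorMap EQ G q (𝔄.modelForm q v) = v := by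
  obtain ⟨h1, h2⟩ := 𝔄.modelLift_spec hπ q
    (modelDeriv 𝓘(ℝ, EQ) 𝓘(ℝ, EB) (orbitProj G : Q → OrbitSpace G Q) q v)
  have h3 := hπ.isPrincipalQuotient_orbitProj.modelDeriv_generator q (𝔄.modelForm q v)
  have h4 := 𝔄.modelForm_generatorMap q (𝔄.modelForm q v)
  refine sub_eq_zero.1 (𝔄.eq_zero_of_vertical_of_horizontal hπ (q := q) ?_ ?_)
  · rw [map_sub, map_add, h1, generatorMap, h3, add_zero, sub_self]
  · rw [map_sub, map_add, h2, h4, zero_add, sub_self]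

lemma modelLift_zero (q : Q) :
    𝔄.modelLift q (0 : EB) = 0 := by
  obtain ⟨h1, h2⟩ := 𝔄.modelLift_spec hπ q 0
  exact 𝔄.eq_zero_of_vertical_of_horizontal hπ h1 h2

end PrincipalConnection

variable [IsManifold 𝓘(ℝ, EB) ∞ (OrbitSpace G Q)] (hπ : IsPrincipalBundle EQ EG EB G Q)
  (𝒜 : AffineDiscreteConnection EQ EG G Q) (𝔄 : PrincipalConnection EQ EG G Q)

/-- The map `v ↦ TΥ(v) ⊕ ½(𝔄(v_0) + 𝔄(v_1))` is injective on `T_x(Q × Q)`: the kernel of `TΥ`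
consists of the vectors `(ξ_Q, ξ_Q)`, on which the second component is `ξ`. -/
lemma eq_zero_of_modelDeriv_reductionMap_eq_zero {x : Q × Q} {v : EQ × EQ}
    (h1 : modelDeriv (𝓘(ℝ, EQ).prod 𝓘(ℝ, EQ)) ((𝓘(ℝ, EB).prod 𝓘(ℝ, EG)).prod 𝓘(ℝ, EB))
      (reductionMap hπ 𝒜) x v = 0) (h2 : (𝔄.prodForm x v : EG) = 0) : v = 0 := by
  obtain ⟨ξ, rfl⟩ :=
    (isPrincipalQuotient_reductionMap hπ 𝒜).exists_generator_of_modelDeriv_eq_zero h1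
  rw [modelDeriv_prod_smul_left] at h2 ⊢
  have h3 : (1 / 2 : ℝ) • (𝔄.modelForm x.1 (generatorMap EQ G x.1 ξ) +
      𝔄.modelForm x.2 (generatorMap EQ G x.2 ξ)) = 0 := h2
  rw [𝔄.modelForm_generatorMap, 𝔄.modelForm_generatorMap, ← two_smul ℝ ξ, smul_smul] at h3
  norm_num at h3
  simp [h3]

lemma modelDeriv_reductionMap_smul (g : G) (x : Q × Q) (v : EQ × EQ) :
    modelDeriv (𝓘(ℝ, EQ).prod 𝓘(ℝ, EQ)) ((𝓘(ℝ, EB).prod 𝓘(ℝ, EG)).prod 𝓘(ℝ, EB))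
      (reductionMap hπ 𝒜) (g • x) (modelDeriv (𝓘(ℝ, EQ).prod 𝓘(ℝ, EQ))
        (𝓘(ℝ, EQ).prod 𝓘(ℝ, EQ)) (fun y : Q × Q => g • y) x v) =
    modelDeriv (𝓘(ℝ, EQ).prod 𝓘(ℝ, EQ)) ((𝓘(ℝ, EB).prod 𝓘(ℝ, EG)).prod 𝓘(ℝ, EB))
      (reductionMap hπ 𝒜) x v := by
  have hp := isPrincipalQuotient_reductionMap hπ 𝒜
  have hd : MDifferentiableAt (𝓘(ℝ, EQ).prod 𝓘(ℝ, EQ)) (𝓘(ℝ, EQ).prod 𝓘(ℝ, EQ))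
      (fun y : Q × Q => g • y) x :=
    (ContMDiffSMul.contMDiff_const_smul (I := 𝓘(ℝ, EG)) (n := ∞) g).mdifferentiable (by simp) x
  rw [← modelDeriv_comp (hp.mdifferentiableAt _) hd rfl]
  exact congrArg (fun f => modelDeriv _ _ f x v) (funext fun y => hp.map_smul g y)

/-- The derivative of `Υ` turns the variation `h(δτ_k) + (ξ_k)_Q` into the reduced variation. -/
lemma modelDeriv_reductionMap_modelLift_add (q₀ q₁ : Q) (δτ₀ δτ₁ : EB) (ξ₀ ξ₁ : EG) :
    modelDeriv (𝓘(ℝ, EQ).prod 𝓘(ℝ, EQ)) ((𝓘(ℝ, EB).prod 𝓘(ℝ, EG)).prod 𝓘(ℝ, EB))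
      (reductionMap hπ 𝒜) (q₀, q₁) (𝔄.modelLift q₀ δτ₀ + generatorMap EQ G q₀ ξ₀,
        𝔄.modelLift q₁ δτ₁ + generatorMap EQ G q₁ ξ₁) =
      (conjugateVariation hπ 𝒜 𝔄 q₀ q₁ δτ₀ δτ₁ ξ₀ ξ₁, δτ₁) := by
  have hρ := (ConjugateBundle.contMDiff_mk hπ).mdifferentiable (by simp) (q₀, 𝒜.toFun (q₀, q₁))
  have hA := 𝒜.contMDiff_toFun.mdifferentiable (by simp) (q₀, q₁)
  have hpr := hπ.isPrincipalQuotient_orbitProj.mdifferentiableAt q₁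
  have hpair : MDifferentiableAt (𝓘(ℝ, EQ).prod 𝓘(ℝ, EQ)) (𝓘(ℝ, EQ).prod 𝓘(ℝ, EG))
      (fun x : Q × Q => (x.1, 𝒜.toFun x)) (q₀, q₁) := mdifferentiableAt_fst.prodMk hA
  have h1 : ∀ v : EQ × EQ, modelDeriv (𝓘(ℝ, EQ).prod 𝓘(ℝ, EQ))
      ((𝓘(ℝ, EB).prod 𝓘(ℝ, EG)).prod 𝓘(ℝ, EB)) (reductionMap hπ 𝒜) (q₀, q₁) v =
      (modelDeriv (𝓘(ℝ, EQ).prod 𝓘(ℝ, EG)) (𝓘(ℝ, EB).prod 𝓘(ℝ, EG)) (ConjugateBundle.mk hπ)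
        (q₀, 𝒜.toFun (q₀, q₁)) (v.1, modelDeriv (𝓘(ℝ, EQ).prod 𝓘(ℝ, EQ)) 𝓘(ℝ, EG) 𝒜.toFun
          (q₀, q₁) v), modelDeriv 𝓘(ℝ, EQ) 𝓘(ℝ, EB) (orbitProj G) q₁ v.2) := by
    intro v
    refine (modelDeriv_prodMk (f := fun x : Q × Q => ConjugateBundle.mk hπ (x.1, 𝒜.toFun x))
      (g := fun x : Q × Q => orbitProj G x.2) (hρ.comp (q₀, q₁) hpair)
      (hpr.comp (q₀, q₁) mdifferentiableAt_snd) v).trans ?_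
    rw [modelDeriv_comp hρ hpair rfl, modelDeriv_comp hpr mdifferentiableAt_snd rfl,
      modelDeriv_prodMk mdifferentiableAt_fst hA, modelDeriv_fst, modelDeriv_snd]
  rw [h1]
  refine Prod.ext ?_ ?_
  · rw [← Prod.mk_add_mk, map_add, Prod.fst_add, ← Prod.mk_add_mk, map_add]
    rfl
  · change modelDeriv 𝓘(ℝ, EQ) 𝓘(ℝ, EB) (orbitProj G) q₁ (_ + _) = _
    rw [map_add, (𝔄.modelLift_spec hπ q₁ δτ₁).1, generatorMap,
      hπ.isPrincipalQuotient_orbitProj.modelDeriv_generator, add_zero]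

end Variations

section ReducedSystem

variable [LieGroup 𝓘(ℝ, EG) ∞ G] [ContMDiffSMul 𝓘(ℝ, EG) 𝓘(ℝ, EQ) ∞ G Q] [IsManifold 𝓘(ℝ, EQ) ∞ Q]
  [IsManifold 𝓘(ℝ, EB) ∞ (OrbitSpace G Q)] (hπ : IsPrincipalBundle EQ EG EB G Q)
  (𝒜 : AffineDiscreteConnection EQ EG G Q) (𝔄 : PrincipalConnection EQ EG G Q)
  {S : ForcedDiscreteSystem EQ Q} (hS : S.IsSymmetryGroup G)

include hS

lemma reducedLagrangian_reductionMap (x : Q × Q) :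
    reducedLagrangian hπ 𝒜 S (reductionMap hπ 𝒜 x) = S.lagrangian x := by
  refine Function.FactorsThrough.extend_apply (fun x y h => ?_) _ _
  obtain ⟨g, rfl⟩ := (reductionMap_eq_iff hπ 𝒜 x y).1 h
  exact (hS.lagrangian_smul g x).symm

lemma modelDeriv_reducedLagrangian (x : Q × Q) (v : EQ × EQ) :
    modelDeriv ((𝓘(ℝ, EB).prod 𝓘(ℝ, EG)).prod 𝓘(ℝ, EB)) 𝓘(ℝ, ℝ) (reducedLagrangian hπ 𝒜 S)
      (reductionMap hπ 𝒜 x) (modelDeriv (𝓘(ℝ, EQ).prod 𝓘(ℝ, EQ))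
        ((𝓘(ℝ, EB).prod 𝓘(ℝ, EG)).prod 𝓘(ℝ, EB)) (reductionMap hπ 𝒜) x v) =
    modelDeriv (𝓘(ℝ, EQ).prod 𝓘(ℝ, EQ)) 𝓘(ℝ, ℝ) S.lagrangian x v := by
  have hp := isPrincipalQuotient_reductionMap hπ 𝒜
  have h : reducedLagrangian hπ 𝒜 S ∘ reductionMap hπ 𝒜 = S.lagrangian :=
    funext (reducedLagrangian_reductionMap hπ 𝒜 hS)
  have hL := hp.contMDiff_of_comp (I'' := 𝓘(ℝ, ℝ)) (f := reducedLagrangian hπ 𝒜 S)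
    (by rw [h]; exact S.contMDiff_lagrangian)
  rw [← modelDeriv_comp (hL.mdifferentiable (by simp) _) (hp.mdifferentiableAt x) rfl, ← h]
  rfl

/-- The reduced force is well defined: tangent vectors with the same image in `T(G̃ × Q/G) ⊕ 𝔤̂`
differ by the action of a group element. -/
lemma reducedForce_reductionMap (x : Q × Q) (v : EQ × EQ) :
    reducedForce hπ 𝒜 𝔄 S (reductionMap hπ 𝒜 x) (modelDeriv (𝓘(ℝ, EQ).prod 𝓘(ℝ, EQ))
        ((𝓘(ℝ, EB).prod 𝓘(ℝ, EG)).prod 𝓘(ℝ, EB)) (reductionMap hπ 𝒜) x v)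
      (AdjointBundle.mk x (𝔄.prodForm x v)) = S.force x v := by
  refine Function.FactorsThrough.extend_apply (f := reductionTangentMap hπ 𝒜 𝔄)
    (g := fun v => S.force v.1 v.2) ?_ _ ⟨x, v⟩
  rintro ⟨x, v⟩ ⟨x', v'⟩ h
  obtain ⟨h1, h2⟩ := Prod.ext_iff.1 h
  obtain ⟨g, hg⟩ := Quotient.exact h2
  obtain ⟨rfl, h3⟩ := Prod.ext_iff.1 hg
  have h4 : modelDeriv (𝓘(ℝ, EQ).prod 𝓘(ℝ, EQ)) ((𝓘(ℝ, EB).prod 𝓘(ℝ, EG)).prod 𝓘(ℝ, EB))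
      (reductionMap hπ 𝒜) x v = modelDeriv (𝓘(ℝ, EQ).prod 𝓘(ℝ, EQ))
      ((𝓘(ℝ, EB).prod 𝓘(ℝ, EG)).prod 𝓘(ℝ, EB)) (reductionMap hπ 𝒜) (g • x) v' :=
    congrArg (fun t : TangentBundle ((𝓘(ℝ, EB).prod 𝓘(ℝ, EG)).prod 𝓘(ℝ, EB))
      (ConjugateBundle hπ × OrbitSpace G Q) => (show (EB × EG) × EB from t.2)) h1
  have h5 : v' = modelDeriv (𝓘(ℝ, EQ).prod 𝓘(ℝ, EQ)) (𝓘(ℝ, EQ).prod 𝓘(ℝ, EQ))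
      (fun y : Q × Q => g • y) x v := by
    refine sub_eq_zero.1 (eq_zero_of_modelDeriv_reductionMap_eq_zero hπ 𝒜 𝔄 (x := g • x) ?_ ?_)
    · exact (map_sub _ _ _).trans
        (sub_eq_zero.2 (h4.symm.trans (modelDeriv_reductionMap_smul hπ 𝒜 g x v).symm))
    · exact (𝔄.prodForm_sub (g • x) v' _).trans
        (sub_eq_zero.2 (h3.symm.trans (𝔄.prodForm_smul g x v).symm))
  subst h5
  exact (hS.force_smul g x v).symm

end ReducedSystem

/-! ### Trajectories and flows -/

section Trajectories

namespace ForcedDiscreteSystem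

variable [IsManifold 𝓘(ℝ, EQ) ∞ Q] {S : ForcedDiscreteSystem EQ Q}

/-- A symmetry group acting by differentiable maps maps trajectories to trajectories. -/
lemma IsTrajectory.smul (hS : S.IsSymmetryGroup G)
    (hg : ∀ g : G, MDifferentiable 𝓘(ℝ, EQ) 𝓘(ℝ, EQ) (fun y : Q => g • y))
    {N : ℕ} {q : Fin (N + 1) → Q} (hq : S.IsTrajectory q) (g : G) :
    S.IsTrajectory fun k => g • q k := by
  intro δq h0 hN
  -- every variation of the translated curve is the translate of a variation
  let T (k) : EQ →L[ℝ] EQ := modelDeriv 𝓘(ℝ, EQ) 𝓘(ℝ, EQ) (fun y : Q => g • y) (q k)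
  let T' (k) : EQ →L[ℝ] EQ := modelDeriv 𝓘(ℝ, EQ) 𝓘(ℝ, EQ) (fun y : Q => g⁻¹ • y) (g • q k)
  have hT (k) (v : EQ) : T k (T' k v) = v := by
    simp only [T, T']
    rw [← modelDeriv_comp (hg g (q k)) (hg g⁻¹ (g • q k)) (inv_smul_smul g (q k))]
    simp only [smul_inv_smul]
    exact modelDeriv_id _ v
  have hpair (x : Q × Q) (v : EQ × EQ) := modelDeriv_prod_smul (hg g) x v
  have hL (x : Q × Q) (v : EQ × EQ) : modelDeriv (𝓘(ℝ, EQ).prod 𝓘(ℝ, EQ)) 𝓘(ℝ, ℝ) S.lagrangian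
      (g • x) (modelDeriv (𝓘(ℝ, EQ).prod 𝓘(ℝ, EQ)) (𝓘(ℝ, EQ).prod 𝓘(ℝ, EQ))
        (fun y : Q × Q => g • y) x v) =
      modelDeriv (𝓘(ℝ, EQ).prod 𝓘(ℝ, EQ)) 𝓘(ℝ, ℝ) S.lagrangian x v := by
    have hd : MDifferentiableAt (𝓘(ℝ, EQ).prod 𝓘(ℝ, EQ)) (𝓘(ℝ, EQ).prod 𝓘(ℝ, EQ))
        (fun y : Q × Q => g • y) x :=
      (hg g).prodMap (hg g) x
    rw [← modelDeriv_comp (S.contMDiff_lagrangian.mdifferentiable (by simp) _) hd rfl]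
    simp only [hS.lagrangian_smul]
  refine Eq.trans ?_ (hq (fun k => T' k (δq k)) ?_ ?_)
  · have hv (k : Fin N) : modelDeriv (𝓘(ℝ, EQ).prod 𝓘(ℝ, EQ)) (𝓘(ℝ, EQ).prod 𝓘(ℝ, EQ))
        (fun y : Q × Q => g • y) (q k.castSucc, q k.succ)
        (T' k.castSucc (δq k.castSucc), T' k.succ (δq k.succ)) =
        (δq k.castSucc, δq k.succ) :=
      (hpair _ _).trans (Prod.ext (hT k.castSucc _) (hT k.succ _))
    refine congrArg₂ _ (Finset.sum_congr rfl fun k _ => ?_) (Finset.sum_congr rfl fun k _ => ?_)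
    · refine Eq.trans ?_ (hL (q k.castSucc, q k.succ) _)
      rw [hv]
      rfl
    · refine Eq.trans ?_ (hS.force_smul g (q k.castSucc, q k.succ) _)
      exact congrArg (S.force (g • (q k.castSucc, q k.succ))) (hv k).symm
  · exact (congrArg (T' 0) h0).trans (map_zero _)
  · exact (congrArg (T' (Fin.last N)) hN).trans (map_zero _)

lemma IsFlow.map_smul (hS : S.IsSymmetryGroup G)
    (hg : ∀ g : G, MDifferentiable 𝓘(ℝ, EQ) 𝓘(ℝ, EQ) (fun y : Q => g • y)) {F : Q × Q → Q × Q}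
    (hF : S.IsFlow F) (g : G) (x : Q × Q) : F (g • x) = g • F x := by
  obtain ⟨q₀, q₁⟩ := x
  obtain ⟨h1, h2⟩ := hF q₀ q₁
  obtain ⟨h1', h2'⟩ := hF (g • q₀) (g • q₁)
  refine Prod.ext (h1'.trans (congrArg (g • ·) h1).symm) ((h2' _).1 ?_)
  convert ((h2 _).2 rfl).smul hS hg g using 1
  funext k
  fin_cases k <;> rfl

end ForcedDiscreteSystem

variable [LieGroup 𝓘(ℝ, EG) ∞ G] [ContMDiffSMul 𝓘(ℝ, EG) 𝓘(ℝ, EQ) ∞ G Q] [IsManifold 𝓘(ℝ, EQ) ∞ Q]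
  [IsManifold 𝓘(ℝ, EB) ∞ (OrbitSpace G Q)] (hπ : IsPrincipalBundle EQ EG EB G Q)
  (𝒜 : AffineDiscreteConnection EQ EG G Q) (𝔄 : PrincipalConnection EQ EG G Q)
  {S : ForcedDiscreteSystem EQ Q} (hS : S.IsSymmetryGroup G)
include hS

/-- The reduced variational equation along `Υ(q_k, q_{k+1})` is the variational equation along `q`,
written in terms of the horizontal and vertical parts of the variations. -/
theorem isReducedTrajectory_iff {N : ℕ} (y : Fin N → ConjugateBundle hπ × OrbitSpace G Q) :
    IsReducedTrajectory hπ 𝒜 𝔄 S y ↔ ∃ q : Fin (N + 1) → Q,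
      (∀ k : Fin N, reductionMap hπ 𝒜 (q k.castSucc, q k.succ) = y k) ∧ S.IsTrajectory q := by
  refine exists_congr fun q => and_congr_right fun _ => ?_
  let δ (δτ : Fin (N + 1) → EB) (ξ : Fin (N + 1) → EG) (k : Fin (N + 1)) : EQ :=
    𝔄.modelLift (q k) (δτ k) + generatorMap EQ G (q k) (ξ k)
  have hΥ (δτ : Fin (N + 1) → EB) (ξ : Fin (N + 1) → EG) (k : Fin N) :=
    modelDeriv_reductionMap_modelLift_add hπ 𝒜 𝔄 (q k.castSucc) (q k.succ) (δτ k.castSucc)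
      (δτ k.succ) (ξ k.castSucc) (ξ k.succ)
  have hL (δτ : Fin (N + 1) → EB) (ξ : Fin (N + 1) → EG) (k : Fin N) :
      (mfderiv ((𝓘(ℝ, EB).prod 𝓘(ℝ, EG)).prod 𝓘(ℝ, EB)) 𝓘(ℝ, ℝ) (reducedLagrangian hπ 𝒜 S)
        (reductionMap hπ 𝒜 (q k.castSucc, q k.succ))
        (conjugateVariation hπ 𝒜 𝔄 (q k.castSucc) (q k.succ) (δτ k.castSucc) (δτ k.succ)
          (ξ k.castSucc) (ξ k.succ), δτ k.succ) : ℝ) =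
      mfderiv (𝓘(ℝ, EQ).prod 𝓘(ℝ, EQ)) 𝓘(ℝ, ℝ) S.lagrangian (q k.castSucc, q k.succ)
        (δ δτ ξ k.castSucc, δ δτ ξ k.succ) := by
    refine Eq.trans ?_ (modelDeriv_reducedLagrangian hπ 𝒜 hS (q k.castSucc, q k.succ)
      (δ δτ ξ k.castSucc, δ δτ ξ k.succ))
    rw [hΥ]
    rfl
  have hf (δτ : Fin (N + 1) → EB) (ξ : Fin (N + 1) → EG) (k : Fin N) :
      reducedForce hπ 𝒜 𝔄 S (reductionMap hπ 𝒜 (q k.castSucc, q k.succ))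
        (conjugateVariation hπ 𝒜 𝔄 (q k.castSucc) (q k.succ) (δτ k.castSucc) (δτ k.succ)
          (ξ k.castSucc) (ξ k.succ), δτ k.succ)
        (AdjointBundle.mk (q k.castSucc, q k.succ) ((1 / 2 : ℝ) • (ξ k.castSucc + ξ k.succ))) =
      S.force (q k.castSucc, q k.succ) (δ δτ ξ k.castSucc, δ δτ ξ k.succ) := by
    refine Eq.trans ?_ (reducedForce_reductionMap hπ 𝒜 𝔄 hS (q k.castSucc, q k.succ)
      (δ δτ ξ k.castSucc, δ δτ ξ k.succ))
    have hform (k) : 𝔄.modelForm (q k) (δ δτ ξ k) = ξ k := by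
      rw [map_add, (𝔄.modelLift_spec hπ _ _).2, 𝔄.modelForm_generatorMap, zero_add]
    rw [hΥ, 𝔄.prodForm_eq, hform, hform]
    rfl
  constructor
  · intro h δq h0 hN
    let δτ (k) : EB := modelDeriv 𝓘(ℝ, EQ) 𝓘(ℝ, EB) (orbitProj G) (q k) (δq k)
    let ξ (k) : EG := 𝔄.modelForm (q k) (δq k)
    have hδ : δ δτ ξ = δq := funext fun k => 𝔄.modelLift_add_generatorMap hπ (q k) (δq k)
    refine Eq.trans ?_ (h δτ ξ ?_ ?_ ?_ ?_)
    · refine congrArg₂ _ (Finset.sum_congr rfl fun k _ => ?_) (Finset.sum_congr rfl fun k _ => ?_)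
      · rw [hL, hδ]
      · exact Eq.trans (by rw [hδ]) (hf δτ ξ k).symm
    · exact (congrArg (modelDeriv 𝓘(ℝ, EQ) 𝓘(ℝ, EB) (orbitProj G) (q 0)) h0).trans (map_zero _)
    · exact (congrArg (modelDeriv 𝓘(ℝ, EQ) 𝓘(ℝ, EB) (orbitProj G) (q (Fin.last N))) hN).trans
        (map_zero _)
    · exact (congrArg (𝔄.modelForm (q 0)) h0).trans (map_zero _)
    · exact (congrArg (𝔄.modelForm (q (Fin.last N))) hN).trans (map_zero _)
  · intro h δτ ξ h0 hN h0' hN'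
    have hδ (k) (a : EB) (b : EG) (ha : a = 0) (hb : b = 0) :
        𝔄.modelLift (q k) a + generatorMap EQ G (q k) b = 0 := by
      rw [ha, hb, map_zero, 𝔄.modelLift_zero hπ, add_zero]
    refine Eq.trans ?_ (h (δ δτ ξ) (hδ 0 _ _ h0 h0') (hδ _ _ _ hN hN'))
    exact congrArg₂ _ (Finset.sum_congr rfl fun k _ => hL δτ ξ k)
      (Finset.sum_congr rfl fun k _ => hf δτ ξ k)

/-- If `q_0`, `q_1`, `q_2` is a trajectory then `Υ(q_0, q_1)`, `Υ(q_1, q_2)` is a reduced one, and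
all reduced trajectories with two points arise in this way. -/
theorem isReducedFlow_of_comp_eq {F : Q × Q → Q × Q} (hF : S.IsFlow F)
    {Fr : ConjugateBundle hπ × OrbitSpace G Q → ConjugateBundle hπ × OrbitSpace G Q}
    (hFr : ∀ x, Fr (reductionMap hπ 𝒜 x) = reductionMap hπ 𝒜 (F x)) :
    IsReducedFlow hπ 𝒜 𝔄 S Fr := by
  intro y z
  rw [isReducedTrajectory_iff hπ 𝒜 𝔄 hS]
  constructor
  · rintro ⟨q, hq, hqt⟩
    have h1 : reductionMap hπ 𝒜 (q 0, q 1) = y := hq 0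
    have h2 : reductionMap hπ 𝒜 (q 1, q 2) = z := hq 1
    have h3 : F (q 0, q 1) = (q 1, q 2) := by
      refine Prod.ext (hF _ _).1 (((hF _ _).2 _).1 ?_)
      convert hqt using 1
      funext k
      fin_cases k <;> rfl
    rw [← h1, ← h2, hFr, h3]
  · rintro rfl
    obtain ⟨⟨q₀, q₁⟩, rfl⟩ := (isPrincipalQuotient_reductionMap hπ 𝒜).surjective y
    obtain ⟨h1, h2⟩ := hF q₀ q₁
    refine ⟨![q₀, q₁, (F (q₀, q₁)).2], fun k => ?_, (h2 _).2 rfl⟩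
    fin_cases k
    · rfl
    · rw [hFr]
      exact congrArg (reductionMap hπ 𝒜) (Prod.ext h1.symm rfl)

end Trajectories

end DiscreteReduction

end

theorem mainTheorem3
    {EQ : Type*} [NormedAddCommGroup EQ] [NormedSpace ℝ EQ] [FiniteDimensional ℝ EQ]
    {EG : Type*} [NormedAddCommGroup EG] [NormedSpace ℝ EG] [FiniteDimensional ℝ EG]
    {EB : Type*} [NormedAddCommGroup EB] [NormedSpace ℝ EB] [FiniteDimensional ℝ EB]
    {Q : Type*} [TopologicalSpace Q] [T2Space Q] [SecondCountableTopology Q]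
    [ChartedSpace EQ Q] [IsManifold 𝓘(ℝ, EQ) ∞ Q]
    {G : Type*} [Group G] [TopologicalSpace G] [T2Space G] [SecondCountableTopology G]
    [ChartedSpace EG G] [LieGroup 𝓘(ℝ, EG) ∞ G]
    [MulAction G Q] [ContMDiffSMul 𝓘(ℝ, EG) 𝓘(ℝ, EQ) ∞ G Q]
    [T2Space (OrbitSpace G Q)] [ChartedSpace EB (OrbitSpace G Q)]
    [IsManifold 𝓘(ℝ, EB) ∞ (OrbitSpace G Q)]
    (hπ : IsPrincipalBundle EQ EG EB G Q)
    (𝒜 : AffineDiscreteConnection EQ EG G Q)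
    (𝔄 : PrincipalConnection EQ EG G Q)
    (S : ForcedDiscreteSystem EQ Q) (hS : S.IsSymmetryGroup G)
    (P : PoissonStructure (𝓘(ℝ, EQ).prod 𝓘(ℝ, EQ)) (Q × Q))
    (hG : ∀ g : G, IsPoissonMap P P (fun x : Q × Q => g • x))
    (F : Q × Q → Q × Q) (hF : S.IsFlow F) (hFP : IsPoissonMap P P F) :
    ∃ Pr : PoissonStructure ((𝓘(ℝ, EB).prod 𝓘(ℝ, EG)).prod 𝓘(ℝ, EB))
        (ConjugateBundle hπ × OrbitSpace G Q),
      IsPoissonMap P Pr (reductionMap hπ 𝒜) ∧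
      ∃ Fr : ConjugateBundle hπ × OrbitSpace G Q → ConjugateBundle hπ × OrbitSpace G Q,
        IsReducedFlow hπ 𝒜 𝔄 S Fr ∧ IsPoissonMap Pr Pr Fr := by
  have hp := isPrincipalQuotient_reductionMap hπ 𝒜
  obtain ⟨Pr, hPr⟩ := hp.exists_poissonStructure P hG
  have hg (g : G) : MDifferentiable 𝓘(ℝ, EQ) 𝓘(ℝ, EQ) (fun y : Q => g • y) :=
    (ContMDiffSMul.contMDiff_const_smul (I := 𝓘(ℝ, EG)) (n := ∞) g).mdifferentiable (by simp)
  obtain ⟨Fr, -, hFr⟩ := hp.exists_contMDiff_comp_eq (hPr.comp hFP).contMDiff fun g x => by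
    rw [Function.comp_apply, hF.map_smul hS hg, hp.map_smul, Function.comp_apply]
  refine ⟨Pr, hPr, Fr, isReducedFlow_of_comp_eq hπ 𝒜 𝔄 hS hF hFr,
    hp.isPoissonMap_of_comp hPr ?_⟩
  rw [show Fr ∘ reductionMap hπ 𝒜 = reductionMap hπ 𝒜 ∘ F from funext hFr]
  exact hPr.comp hFP
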